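/- For $k\in\mathbb N$, a $k$-dimensional pushdown vector addition system (PVAS) is a tuple $(Q,\Gamma,q_{\mathrm{init}},\vec c_{\mathrm{init}},w_{\mathrm{init}},\Delta)$ where $Q$ is a finite set of states, $\Gamma$ is a finite stack alphabet, $q_{\mathrm{init}}\in Q$, $\vec c_{\mathrm{init}}\in\mathbb N^k$, $w_{\mathrm{init}}\in\Gamma^*$, and $\Delta\subseteq Q\times\mathbb Z^k\times \mathrm{Op}(\Gamma)\times Q$ is a finite set of transitions, with $\mathrm{Op}(\Gamma)=\{\mathrm{push}(\gamma),\mathrm{pop}(\gamma),\mathrm{nop}\mid\gamma\in\Gamma\}$. A configuration is a triple $(q,\vec c,w)\in Q\times\mathbb N^k\times\Gamma^*$. There is a step $(p,\vec c,u)\to(q,\vec d,v)$ if some transition $(p,\vec a,\mathrm{op},q)\in\Delta$ satisfies $\vec d=\vec c+\vec a$ and either $\mathrm{op}=\mathrm{push}(\gamma)$ and $v=u\gamma$, or $\mathrm{op}=\mathrm{pop}(\gamma)$ and $u=v\gamma$, or $\mathrm{op}=\mathrm{nop}$ and $u=v$. A configuration is reachable if it is obtained from $(q_{\mathrm{init}},\vec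 c_{\mathrm{init}},w_{\mathrm{init}})$ by finitely many (possibly zero) steps. The PVAS is stack-bounded if the set of words $w\in\Gamma^*$ such that $(q,\vec c,w)$ is reachable for some $q$ and $\vec c$ is finite. **Lemma.** The stack-boundedness problem for PVAS is decidable: there is an algorithm that, given (a finite encoding of) a PVAS of any dimension $k$, decides whether it is stack-bounded. -/

import Mathlib

/-- Stack operations over a stack alphabet `Γ`. -/
inductive StackOp (Γ : Type*) where
  | push (γ : Γ) : StackOp Γ
  | pop (γ : Γ) : StackOp Γ
  | nop : StackOp Γ

/-- A `k`-dimensional pushdown vector addition system with states `Q` and stack alphabet `Γ`.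
Finiteness of `Q` and `Γ` is imposed where such a system is used as the input of an algorithm:
there, both come with a numbering by `Fin n` and `Fin m`. -/
structure PVAS (k : ℕ) (Q Γ : Type*) where
  /-- the initial state -/
  qInit : Q
  /-- the initial assignment of the counters -/
  cInit : Fin k → ℕ
  /-- the initial stack content; the top of the stack is the end of the list -/
  wInit : List Γ
  /-- the finite set of transitions -/
  Δ : Finset (Q × (Fin k → ℤ) × StackOp Γ × Q)

namespace PVAS

/-- The effect of a stack operation on stack contents; the top is the end of the list. -/
def StackStep {Γ : Type*} : StackOp Γ → List Γ → List Γ → Prop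
  | StackOp.push γ, u, v => v = u ++ [γ]
  | StackOp.pop γ, u, v => u = v ++ [γ]
  | StackOp.nop, u, v => u = v

/-- The effect of an action `a ∈ ℤ^k` on `ℕ^k`: `d = c + a`, computed in `ℤ^k`. -/
def CounterStep {k : ℕ} (a : Fin k → ℤ) (c d : Fin k → ℕ) : Prop :=
  ∀ i, (d i : ℤ) = (c i : ℤ) + a i

/-- Configurations: a state, a counter valuation in `ℕ^k`, and a stack content. -/
abbrev Config (k : ℕ) (Q Γ : Type*) := Q × (Fin k → ℕ) × List Γ

variable {k : ℕ} {Q Γ : Type*}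

/-- The step relation of a PVAS. -/
def Step (P : PVAS k Q Γ) (x y : Config k Q Γ) : Prop :=
  ∃ (a : Fin k → ℤ) (op : StackOp Γ), (x.1, a, op, y.1) ∈ P.Δ ∧
    CounterStep a x.2.1 y.2.1 ∧ StackStep op x.2.2 y.2.2

/-- The reachability set of a PVAS. -/
def reachSet (P : PVAS k Q Γ) : Set (Config k Q Γ) :=
  {x | Relation.ReflTransGen P.Step (P.qInit, P.cInit, P.wInit) x}

/-- A PVAS is stack-bounded if only finitely many stack contents occur in its reachability set. -/
def StackBounded (P : PVAS k Q Γ) : Prop :=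
  {w : List Γ | ∃ (q : Q) (c : Fin k → ℕ), (q, c, w) ∈ P.reachSet}.Finite

/-- Codes of transitions: source state, action, stack operation, target state. The stack operation
is coded by `none` for `nop`, `some (inl γ)` for `push γ`, `some (inr γ)` for `pop γ`. -/
abbrev TransCode := ℕ × List ℤ × Option (ℕ ⊕ ℕ) × ℕ

/-- Codes of PVAS: dimension, number of states, number of stack symbols, initial state,
initial counters, initial stack content, list of transitions. -/
abbrev Code := ℕ × ℕ × ℕ × ℕ × List ℕ × List ℕ × List TransCode

/-- The code of a stack operation under a numbering of the stack symbols. -/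
def opCode {m : ℕ} (eΓ : Γ ≃ Fin m) : StackOp Γ → Option (ℕ ⊕ ℕ)
  | StackOp.push γ => some (Sum.inl (eΓ γ : ℕ))
  | StackOp.pop γ => some (Sum.inr (eΓ γ : ℕ))
  | StackOp.nop => none

/-- The code of a transition under numberings of the states and of the stack symbols. -/
def transCode {n m : ℕ} (eQ : Q ≃ Fin n) (eΓ : Γ ≃ Fin m)
    (t : Q × (Fin k → ℤ) × StackOp Γ × Q) : TransCode :=
  ((eQ t.1 : ℕ), List.ofFn t.2.1, opCode eΓ t.2.2.1, (eQ t.2.2.2 : ℕ))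

/-- The code of a PVAS, under numberings of its (finitely many) states and stack symbols, and
with its transitions listed in the order `ts`. -/
def code {n m : ℕ} (P : PVAS k Q Γ) (eQ : Q ≃ Fin n) (eΓ : Γ ≃ Fin m)
    (ts : List (Q × (Fin k → ℤ) × StackOp Γ × Q)) : Code :=
  (k, n, m, (eQ P.qInit : ℕ), List.ofFn P.cInit, P.wInit.map (fun γ => (eΓ γ : ℕ)),
    ts.map (transCode eQ eΓ))

end PVAS

/-! By Post's theorem it suffices that stack-boundedness and its negation are both Sigma-1, so each
of the two needs finite certificates that can be searched for.

Unboundedness is certified in the manner of Karp and Miller. From a reachable configuration, take a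
loop that never reads below the current stack, restores state and stack, decreases no counter and
increases counter `i`. Repeating it makes `i` as large as desired, so from then on `i` may be
frozen, that is, ignored. A certificate chains frozen steps and such accelerations and ends with a
nondecreasing loop that leaves a nonempty word on the stack (`StackPumpable`). Conversely,
`finite_stacks_of_pumpable` shows by induction on the number of unfrozen counters that without a
certificate only finitely many stacks occur. Otherwise König's lemma gives an infinite path without
repetitions. Dickson's lemma, applied to the positions whose stack height is never undercut later,
gives a nondecreasing loop. Its net push must be empty, so some counter strictly grows. Freezing
this counter loses no stack content, and the induction hypothesis applies.

Boundedness is certified by a finite inductive invariant: the finite list `W` of stacks and, for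
each relevant state and stack, the minimal counter vectors that no reachable configuration
dominates. There are finitely many of them by Dickson's lemma
(`stackBounded_iff_exists_isInvariant`).

The remaining work transfers both certificates to codes and shows that checking them is primitive
recursive up to existential quantifiers. -/

/-! ### Sigma-1 predicates and their closure properties -/

/-- Predicates of the form `∃ n, q (a, n)` with `q` primitive recursive. -/
def IsSigma1 {α : Type*} [Primcodable α] (p : α → Prop) : Prop :=
  ∃ q : α → ℕ → Bool, Primrec₂ q ∧ ∀ a, p a ↔ ∃ n, q a n = true

namespace IsSigma1

variable {α β : Type*} [Primcodable α] [Primcodable β] {p r : α → Prop}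

theorem of_eq (hp : IsSigma1 p) (h : ∀ a, p a ↔ r a) : IsSigma1 r := by
  obtain ⟨q, hq, hpq⟩ := hp
  exact ⟨q, hq, fun a => (h a).symm.trans (hpq a)⟩

theorem _root_.PrimrecPred.isSigma1 (hp : PrimrecPred p) : IsSigma1 p := by
  obtain ⟨_, hp⟩ := hp
  exact ⟨fun a _ => decide (p a), hp.comp Primrec.fst, fun a => by simp⟩

theorem comp {p : β → Prop} (hp : IsSigma1 p) {f : α → β} (hf : Primrec f) :
    IsSigma1 fun a => p (f a) := by
  obtain ⟨q, hq, hpq⟩ := hp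
  exact ⟨fun a n => q (f a) n, hq.comp (hf.comp Primrec.fst) Primrec.snd, fun a => hpq (f a)⟩

theorem and (hp : IsSigma1 p) (hr : IsSigma1 r) : IsSigma1 fun a => p a ∧ r a := by
  obtain ⟨q, hq, hpq⟩ := hp
  obtain ⟨s, hs, hrs⟩ := hr
  refine ⟨fun a n => q a n.unpair.1 && s a n.unpair.2, ?_, fun a => ?_⟩
  · exact Primrec.and.comp
      (hq.comp Primrec.fst (Primrec.fst.comp (Primrec.unpair.comp Primrec.snd)))
      (hs.comp Primrec.fst (Primrec.snd.comp (Primrec.unpair.comp Primrec.snd)))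
  · beta_reduce
    rw [hpq, hrs]
    constructor
    · rintro ⟨⟨m, hm⟩, n, hn⟩
      exact ⟨Nat.pair m n, by simp [hm, hn]⟩
    · rintro ⟨n, hn⟩
      rw [Bool.and_eq_true] at hn
      exact ⟨⟨_, hn.1⟩, _, hn.2⟩

theorem or (hp : IsSigma1 p) (hr : IsSigma1 r) : IsSigma1 fun a => p a ∨ r a := by
  obtain ⟨q, hq, hpq⟩ := hp
  obtain ⟨s, hs, hrs⟩ := hr
  refine ⟨fun a n => q a n || s a n, ?_, fun a => ?_⟩
  · exact Primrec.or.comp hq hs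
  · simp [hpq, hrs, exists_or]

/-- Sigma-1 predicates are closed under existential quantification. -/
theorem exists_snd {p : α × β → Prop} (hp : IsSigma1 p) : IsSigma1 fun a => ∃ b, p (a, b) := by
  obtain ⟨q, hq, hpq⟩ := hp
  refine ⟨fun a n => ((Encodable.decode (α := β) n.unpair.1).map
    fun b => q (a, b) n.unpair.2).getD false, ?_, fun a => ?_⟩
  · refine Primrec.option_getD.comp (Primrec.option_map (Primrec.decode.comp
      (Primrec.fst.comp (Primrec.unpair.comp Primrec.snd))) ?_) (Primrec.const false)
    exact hq.comp
      (Primrec.pair (Primrec.fst.comp Primrec.fst) Primrec.snd)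
      (Primrec.snd.comp (Primrec.unpair.comp (Primrec.snd.comp Primrec.fst)))
  · simp only [hpq]
    constructor
    · rintro ⟨b, n, hn⟩
      exact ⟨Nat.pair (Encodable.encode b) n, by simp [hn]⟩
    · rintro ⟨n, hn⟩
      cases hb : Encodable.decode (α := β) n.unpair.1 with
      | none => simp [hb] at hn
      | some b => exact ⟨b, _, by simpa [hb] using hn⟩

/-- Sigma-1 predicates are closed under existential quantification. -/
theorem exists_right {p : α → β → Prop} (hp : IsSigma1 fun x : α × β => p x.1 x.2) :
    IsSigma1 fun a => ∃ b, p a b :=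
  hp.exists_snd

/-- The reflexive transitive closure of a Sigma-1 relation is Sigma-1. -/
theorem reflTransGen {R : α → β → β → Prop} (hR : IsSigma1 fun x : α × β × β => R x.1 x.2.1 x.2.2) :
    IsSigma1 fun x : α × β × β => Relation.ReflTransGen (R x.1) x.2.1 x.2.2 := by
  classical
  obtain ⟨q, hq, hpq⟩ := hR
  -- A path is certified by a list of pairs (next vertex, witness that the step to it is allowed).
  -- Folding `next` replays the path and yields `none` as soon as a witness fails.
  let next (a : α) (o : Option β) (e : β × ℕ) : Option β :=
    o.bind fun b => bif q (a, b, e.1) e.2 then some e.1 else none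
  have key (a : α) (x y : β) : Relation.ReflTransGen (R a) x y ↔
      ∃ l : List (β × ℕ), l.foldl (next a) (some x) = some y := by
    constructor
    · intro h
      induction h with
      | refl => exact ⟨[], rfl⟩
      | @tail b c _ hbc ih =>
        obtain ⟨l, hl⟩ := ih
        obtain ⟨n, hn⟩ := (hpq (a, b, c)).1 hbc
        exact ⟨l ++ [(c, n)], by simp [List.foldl_append, hl, next, hn]⟩
    · rintro ⟨l, hl⟩
      induction l using List.reverseRecOn generalizing y with
      | nil => simp at hl; exact hl ▸ .refl
      | append_singleton l e ih =>
        rw [List.foldl_append] at hl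
        simp only [List.foldl_cons, List.foldl_nil] at hl
        cases hb : l.foldl (next a) (some x) with
        | none => simp [hb, next] at hl
        | some b =>
          simp only [hb, next, Option.bind_some] at hl
          cases hc : q (a, b, e.1) e.2 with
          | false => simp [hc] at hl
          | true =>
            simp [hc] at hl
            subst hl
            exact (ih b hb).tail ((hpq (a, b, e.1)).2 ⟨_, hc⟩)
  refine of_eq (p := fun x : α × β × β => ∃ l : List (β × ℕ),
    l.foldl (next x.1) (some x.2.1) = some x.2.2) (exists_right (PrimrecPred.isSigma1 ?_))
    fun x => (key _ _ _).symm
  refine PrimrecRel.comp Primrec.eq (Primrec.list_foldl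
    (h := fun (z : (α × β × β) × List (β × ℕ)) (e : Option β × β × ℕ) => next z.1.1 e.1 e.2)
    Primrec.snd
    (Primrec.option_some.comp (Primrec.fst.comp (Primrec.snd.comp Primrec.fst))) ?_)
    (Primrec.option_some.comp (Primrec.snd.comp (Primrec.snd.comp Primrec.fst)))
  refine Primrec.option_bind (Primrec.fst.comp Primrec.snd) (Primrec.cond ?_ ?_ ?_)
  · refine hq.comp (Primrec.pair ?_ (Primrec.pair ?_ ?_)) ?_
    · exact Primrec.fst.comp (Primrec.fst.comp (Primrec.fst.comp Primrec.fst))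
    · exact Primrec.snd
    · exact Primrec.fst.comp (Primrec.snd.comp (Primrec.snd.comp Primrec.fst))
    · exact Primrec.snd.comp (Primrec.snd.comp (Primrec.snd.comp Primrec.fst))
  · exact Primrec.option_some.comp (Primrec.fst.comp (Primrec.snd.comp (Primrec.snd.comp Primrec.fst)))
  · exact Primrec.const none

theorem rePred (hp : IsSigma1 p) : REPred p := by
  obtain ⟨q, hq, hpq⟩ := hp
  have h : Partrec fun a => Nat.rfind ((fun n => Part.some (q a n)) : ℕ →. Bool) :=
    Partrec.rfind (Computable.partrec hq.to_comp)
  refine (h.dom_re).of_eq fun a => ?_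
  rw [hpq]
  refine Nat.rfind_dom.trans ?_
  simp

end IsSigma1

/-! ### Frozen counters and acceleration -/

namespace PVAS

variable {k : ℕ} {Q Γ : Type*}

open Relation

/-- The steps of a PVAS in which the counters in `X` are neither tested nor changed. -/
def FrozenStep (P : PVAS k Q Γ) (X : Set (Fin k)) (x y : Config k Q Γ) : Prop :=
  ∃ (a : Fin k → ℤ) (op : StackOp Γ), (x.1, a, op, y.1) ∈ P.Δ ∧
    (∀ i, (i ∈ X → y.2.1 i = x.2.1 i) ∧ (i ∉ X → (y.2.1 i : ℤ) = (x.2.1 i : ℤ) + a i)) ∧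
    StackStep op x.2.2 y.2.2

/-- Reachability by steps in which the counters in `X` are frozen. -/
def FrozenReach (P : PVAS k Q Γ) (X : Set (Fin k)) : Config k Q Γ → Config k Q Γ → Prop :=
  ReflTransGen (P.FrozenStep X)

theorem frozenStep_empty (P : PVAS k Q Γ) : P.FrozenStep ∅ = P.Step := by
  funext x y
  simp [FrozenStep, Step, CounterStep]

theorem StackStep.append_left {op : StackOp Γ} {u v : List Γ} (h : StackStep op u v)
    (w : List Γ) : StackStep op (w ++ u) (w ++ v) := by
  cases op <;> simp_all [StackStep]

/-- A step between stacks that both extend `w` is a step between the parts above `w`. -/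
theorem StackStep.of_append {op : StackOp Γ} {w u v : List Γ} (h : StackStep op (w ++ u) v)
    (hv : w.length ≤ v.length) : ∃ v', v = w ++ v' ∧ StackStep op u v' := by
  cases op with
  | push γ => exact ⟨u ++ [γ], by simpa [StackStep] using h, rfl⟩
  | nop => exact ⟨u, h.symm, rfl⟩
  | pop γ =>
    have h' : w ++ u = v ++ [γ] := h
    have hw : w <+: v := List.prefix_of_prefix_length_le (List.prefix_append w u)
      (h' ▸ List.prefix_append v [γ]) hv
    obtain ⟨v', rfl⟩ := hw
    exact ⟨v', rfl, by simpa [StackStep] using h'⟩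

/-- The pairs `(X, (q, c, w))` such that the configurations `(q, d, w)` with `c ≤ d` outside `X`
and with `d` arbitrarily large in `X` are seen to be reachable by accelerating loops. -/
inductive Pumpable (P : PVAS k Q Γ) : Set (Fin k) → Config k Q Γ → Prop
  | init : Pumpable P ∅ (P.qInit, P.cInit, P.wInit)
  | step {X : Set (Fin k)} {x y : Config k Q Γ} :
      Pumpable P X x → P.FrozenStep X x y → Pumpable P X y
  | accel {X : Set (Fin k)} {q : Q} {c c' : Fin k → ℕ} {w : List Γ} {i : Fin k} :
      Pumpable P X (q, c, w) → P.FrozenReach X (q, c, []) (q, c', []) → c ≤ c' → c i < c' i →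
      Pumpable P (insert i X) (q, c, w)

/-- A witness of an unbounded stack: a loop that pushes a nonempty word, from a pumpable
configuration. -/
def StackPumpable (P : PVAS k Q Γ) : Prop :=
  ∃ (X : Set (Fin k)) (q : Q) (c : Fin k → ℕ) (w : List Γ) (c' : Fin k → ℕ) (u : List Γ),
    P.Pumpable X (q, c, w) ∧ P.FrozenReach X (q, c, []) (q, c', u) ∧ c ≤ c' ∧ u ≠ []

/-! ### Pumpable configurations are realized by actual runs -/

section Soundness

variable {P : PVAS k Q Γ} {X : Set (Fin k)}

/-- `K` bounds every entry of the action in absolute value, so counters in `X` that are at least `K`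
cannot block the step and lose at most `K`. -/
theorem FrozenStep.exists_step {x y : Config k Q Γ} (h : P.FrozenStep X x y) :
    ∃ K : ℕ, ∀ (d : Fin k → ℕ) (w : List Γ), (∀ i ∉ X, x.2.1 i ≤ d i) → (∀ i ∈ X, K ≤ d i) →
      ∃ d' : Fin k → ℕ, P.Step (x.1, d, w ++ x.2.2) (y.1, d', w ++ y.2.2) ∧
        (∀ i ∉ X, d' i + x.2.1 i = d i + y.2.1 i) ∧ ∀ i ∈ X, d i ≤ d' i + K := by
  obtain ⟨a, op, ht, hc, hs⟩ := h
  have hK (i : Fin k) : (a i).natAbs ≤ ∑ j, (a j).natAbs :=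
    Finset.single_le_sum (f := fun j => (a j).natAbs) (fun _ _ => Nat.zero_le _) (Finset.mem_univ i)
  refine ⟨∑ i, (a i).natAbs, fun d w hd hdX => ⟨fun i => (d i + a i).toNat,
    ⟨a, op, ht, fun i => ?_, hs.append_left w⟩, fun i hi => ?_, fun i hi => ?_⟩⟩
  · have h1 := hK i
    by_cases hi : i ∈ X
    · have := hdX i hi
      simp only; omega
    · have := hd i hi
      have := (hc i).2 hi
      simp only; omega
  · have := hd i hi
    have := (hc i).2 hi
    simp only; omega
  · have h1 := hK i
    have := hdX i hi
    simp only; omega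

theorem FrozenReach.exists_reach {x y : Config k Q Γ} (h : P.FrozenReach X x y) :
    ∃ K : ℕ, ∀ (d : Fin k → ℕ) (w : List Γ), (∀ i ∉ X, x.2.1 i ≤ d i) → (∀ i ∈ X, K ≤ d i) →
      ∃ d' : Fin k → ℕ, ReflTransGen P.Step (x.1, d, w ++ x.2.2) (y.1, d', w ++ y.2.2) ∧
        (∀ i ∉ X, d' i + x.2.1 i = d i + y.2.1 i) ∧ ∀ i ∈ X, d i ≤ d' i + K := by
  induction h with
  | refl => exact ⟨0, fun d w _ _ => ⟨d, .refl, fun i _ => rfl, fun i _ => le_rfl⟩⟩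
  | @tail y z _ hyz ih =>
    obtain ⟨K, hK⟩ := ih
    obtain ⟨L, hL⟩ := hyz.exists_step
    refine ⟨K + L, fun d w hd hdX => ?_⟩
    obtain ⟨d', h1, h2, h3⟩ := hK d w hd fun i hi => by have := hdX i hi; omega
    obtain ⟨d'', h4, h5, h6⟩ := hL d' w
      (fun i hi => by have := h2 i hi; have := hd i hi; omega)
      (fun i hi => by have := h3 i hi; have := hdX i hi; omega)
    exact ⟨d'', h1.tail h4, fun i hi => by have := h2 i hi; have := h5 i hi; omega,
      fun i hi => by have := h3 i hi; have := h6 i hi; omega⟩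

/-- A loop that does not decrease the counters can be iterated. -/
theorem FrozenReach.exists_iterate {q : Q} {c c' : Fin k → ℕ} {u : List Γ}
    (h : P.FrozenReach X (q, c, []) (q, c', u)) (hcc : c ≤ c') :
    ∃ K : ℕ, ∀ (n : ℕ) (d : Fin k → ℕ) (w : List Γ), (∀ i ∉ X, c i ≤ d i) →
      (∀ i ∈ X, n * K ≤ d i) →
      ∃ d' : Fin k → ℕ,
        ReflTransGen P.Step (q, d, w) (q, d', w ++ (List.replicate n u).flatten) ∧
        (∀ i ∉ X, d' i + n * c i = d i + n * c' i) ∧ ∀ i ∈ X, d i ≤ d' i + n * K := by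
  obtain ⟨K, hK⟩ := h.exists_reach
  refine ⟨K, fun n => ?_⟩
  induction n with
  | zero => exact fun d w _ _ => ⟨d, by simpa using .refl, by simp, by simp⟩
  | succ n ih =>
    intro d w hd hdX
    obtain ⟨d', h1, h2, h3⟩ := hK d w hd fun i hi => by have := hdX i hi; rw [add_mul] at this; omega
    simp only [List.append_nil] at h1 h2
    obtain ⟨d'', h4, h5, h6⟩ := ih d' (w ++ u)
      (fun i hi => by have := h2 i hi; have := hd i hi; have : c i ≤ c' i := hcc i; omega)
      (fun i hi => by have := h3 i hi; have := hdX i hi; rw [add_mul] at this; omega)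
    refine ⟨d'', ?_, fun i hi => ?_, fun i hi => ?_⟩
    · rw [List.replicate_succ, List.flatten_cons, ← List.append_assoc]
      exact h1.trans h4
    · have := h2 i hi
      have := h5 i hi
      rw [add_mul, add_mul]; omega
    · have := h3 i hi
      have := h6 i hi
      rw [add_mul]; omega

theorem Pumpable.exists_mem_reachSet {x : Config k Q Γ} (h : P.Pumpable X x) (N : ℕ) :
    ∃ d : Fin k → ℕ, (x.1, d, x.2.2) ∈ P.reachSet ∧ (∀ i ∉ X, x.2.1 i ≤ d i) ∧
      ∀ i ∈ X, N ≤ d i := by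
  induction h generalizing N with
  | init => exact ⟨P.cInit, .refl, fun _ _ => le_rfl, fun i hi => hi.elim⟩
  | step _ hxy ih =>
    obtain ⟨K, hK⟩ := hxy.exists_step
    obtain ⟨d, h1, h2, h3⟩ := ih (N + K)
    obtain ⟨d', h4, h5, h6⟩ := hK d [] h2 fun i hi => by have := h3 i hi; omega
    exact ⟨d', ReflTransGen.tail h1 h4, fun i hi => by have := h2 i hi; have := h5 i hi; omega,
      fun i hi => by have := h3 i hi; have := h6 i hi; omega⟩
  | @accel X q c c' w i _ hr hcc hi ih =>
    obtain ⟨K, hK⟩ := hr.exists_iterate hcc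
    -- The loop is run `N` times. This costs an already frozen counter at most `N * K`, and the new
    -- counter `i` gains at least one per round.
    obtain ⟨d, h1, h2, h3⟩ := ih (N + N * K)
    obtain ⟨d', h4, h5, h6⟩ := hK N d w h2 fun i hi => by have := h3 i hi; omega
    refine ⟨d', ?_, fun j hj => ?_, fun j hj => ?_⟩
    · have : (List.replicate N ([] : List Γ)).flatten = [] := by simp
      rw [this, List.append_nil] at h4
      exact ReflTransGen.trans h1 h4
    · have hj' : j ∉ X := fun h => hj (Set.mem_insert_of_mem _ h)
      have := h5 j hj'
      have := h2 j hj'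
      have := Nat.mul_le_mul_left N (hcc j)
      simp only at *; omega
    · by_cases hjX : j ∈ X
      · have := h3 j hjX
        have := h6 j hjX
        omega
      · obtain rfl : j = i := hj.resolve_right hjX
        have := h5 j hjX
        have := Nat.mul_le_mul_left N (Nat.succ_le_of_lt hi)
        rw [Nat.mul_succ] at this
        omega

theorem StackPumpable.not_stackBounded (h : P.StackPumpable) : ¬ P.StackBounded := by
  obtain ⟨X, q, c, w, c', u, hp, hr, hcc, hu⟩ := h
  obtain ⟨K, hK⟩ := hr.exists_iterate hcc
  have hmem (n : ℕ) : w ++ (List.replicate n u).flatten ∈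
      {w : List Γ | ∃ (q : Q) (c : Fin k → ℕ), (q, c, w) ∈ P.reachSet} := by
    obtain ⟨d, h1, h2, h3⟩ := hp.exists_mem_reachSet (n * K)
    obtain ⟨d', h4, -, -⟩ := hK n d w h2 h3
    exact ⟨q, d', ReflTransGen.trans h1 h4⟩
  refine Set.infinite_of_injective_forall_mem (fun m n hmn => ?_) hmem
  have := congrArg List.length hmn
  have hu' := List.length_pos_iff.2 hu
  simpa [hu'.ne'] using this

end Soundness

/-! ### Without a pumping witness, only finitely many stacks occur -/

section Completeness

/-- Cut the path at its last visit to `s`; what remains avoids `s` as well as `V`. -/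
theorem exists_reflTransGen_avoiding_of_ne {α : Type*} {R : α → α → Prop} {V : Set α} {s y : α}
    (h : ReflTransGen (fun a b => R a b ∧ b ∉ V) s y) :
    y = s ∨ ∃ s', R s s' ∧ s' ∉ insert s V ∧
      ReflTransGen (fun a b => R a b ∧ b ∉ insert s V) s' y := by
  induction h with
  | refl => exact .inl rfl
  | @tail y z _ hyz ih =>
    by_cases hz : z = s
    · exact .inl hz
    have hz' : z ∉ insert s V := fun h => h.elim hz hyz.2
    refine .inr ?_
    rcases ih with rfl | ⟨s', h1, h2, h3⟩
    · exact ⟨z, hyz.1, hz', .refl⟩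
    · exact ⟨s', h1, h2, h3.tail ⟨hyz.1, hz'⟩⟩

/-- A form of König's lemma: in a finitely branching relation, if a function takes infinitely many
values on the elements reachable from `s`, then there is an infinite path without repetitions
from `s` all of whose elements have this property. -/
theorem exists_injective_path {α β : Type*} {R : α → α → Prop} (hR : ∀ x, {y | R x y}.Finite)
    (f : α → β) {s : α} (hs : (f '' {y | ReflTransGen R s y}).Infinite) :
    ∃ σ : ℕ → α, σ 0 = s ∧ σ.Injective ∧ (∀ n, R (σ n) (σ (n + 1))) ∧
      ∀ n, (f '' {y | ReflTransGen R (σ n) y}).Infinite := by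
  -- A state of the construction is a set of visited vertices together with a current vertex from
  -- which infinitely many values occur on paths avoiding the visited ones.
  let S := {p : Set α × α // (f '' {y | ReflTransGen (fun a b => R a b ∧ b ∉ p.1) p.2 y}).Infinite}
  have next (p : S) : ∃ p' : S, p'.1.1 = insert p.1.2 p.1.1 ∧ R p.1.2 p'.1.2 ∧
      p'.1.2 ∉ insert p.1.2 p.1.1 := by
    obtain ⟨⟨V, x⟩, hp⟩ := p
    by_contra! hcon
    refine hp (((Set.finite_singleton (f x)).union (((hR x).subset
      (Set.sep_subset _ (fun x' => x' ∉ insert x V))).biUnion (t := fun x' =>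
        f '' {y | ReflTransGen (fun a b => R a b ∧ b ∉ insert x V) x' y}) ?_)).subset ?_)
    · rintro x' ⟨h1, h2⟩
      by_contra hinf
      exact h2 (hcon ⟨(insert x V, x'), hinf⟩ rfl h1)
    · rintro _ ⟨y, hy, rfl⟩
      rcases exists_reflTransGen_avoiding_of_ne hy with rfl | ⟨x', h1, h2, h3⟩
      · exact .inl rfl
      · exact .inr (Set.mem_biUnion (⟨h1, h2⟩ : x' ∈ {y ∈ {y | R x y} | y ∉ insert x V}) ⟨y, h3, rfl⟩)
  choose g hg1 hg2 hg3 using next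
  let p₀ : S := ⟨(∅, s), by simpa using hs⟩
  let p : ℕ → S := fun n => g^[n] p₀
  have hp (n : ℕ) : p (n + 1) = g (p n) := Function.iterate_succ_apply' g n p₀
  have hmem (m n : ℕ) (h : m < n) : (p m).1.2 ∈ (p n).1.1 := by
    induction n, h using Nat.le_induction with
    | base => rw [hp, hg1]; exact Set.mem_insert _ _
    | succ n _ ih => rw [hp, hg1]; exact Set.mem_insert_of_mem _ ih
  have hnot (n : ℕ) : (p n).1.2 ∉ (p n).1.1 := by
    cases n with
    | zero => exact Set.notMem_empty _
    | succ n => rw [hp, hg1]; exact hg3 _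
  have hne (m n : ℕ) (h : m < n) : (p m).1.2 ≠ (p n).1.2 := fun heq => hnot n (heq ▸ hmem m n h)
  refine ⟨fun n => (p n).1.2, rfl, fun m n hmn => ?_, fun n => ?_, fun n => ?_⟩
  · rcases lt_trichotomy m n with h | h | h
    · exact (hne m n h hmn).elim
    · exact h
    · exact (hne n m h hmn.symm).elim
  · simp only [hp]
    exact hg2 _
  · refine (p n).2.mono (Set.image_mono fun y hy => ?_)
    exact ReflTransGen.mono (fun _ _ h => h.1) _ _ hy

/-- The minimum of `h` over the indices from `N` on is attained. For stack heights along a path,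
this gives infinitely many positions below whose stack the path never descends again. -/
theorem exists_forall_ge_le (h : ℕ → ℕ) (N : ℕ) : ∃ i ≥ N, ∀ j ≥ i, h i ≤ h j := by
  classical
  have hex : ∃ m, ∃ i ≥ N, h i = m := ⟨h N, N, le_rfl, rfl⟩
  obtain ⟨i, hi, him⟩ := Nat.find_spec hex
  exact ⟨i, hi, fun j hj => him ▸ Nat.find_min' hex ⟨j, hi.trans hj, rfl⟩⟩

variable {P : PVAS k Q Γ} {X : Set (Fin k)}

theorem finite_frozenStep (P : PVAS k Q Γ) (X : Set (Fin k)) (x : Config k Q Γ) :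
    {y | P.FrozenStep X x y}.Finite := by
  classical
  refine (P.Δ.finite_toSet.image fun t => ((t.2.2.2,
    (fun i => if i ∈ X then x.2.1 i else ((x.2.1 i : ℤ) + t.2.1 i).toNat),
    match t.2.2.1 with
    | .push γ => x.2.2 ++ [γ]
    | .pop _ => x.2.2.dropLast
    | .nop => x.2.2) : Config k Q Γ)).subset ?_
  rintro ⟨q, d, v⟩ ⟨a, op, ht, hc, hs⟩
  refine ⟨_, ht, ?_⟩
  refine Prod.ext rfl (Prod.ext (funext fun i => ?_) ?_)
  · by_cases hi : i ∈ X
    · simpa [hi] using ((hc i).1 hi).symm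
    · have := (hc i).2 hi
      simp only [hi, if_false] at this ⊢
      omega
  · cases op <;> simp_all [StackStep]

theorem FrozenReach.frozen {x y : Config k Q Γ} (h : P.FrozenReach X x y) {i : Fin k}
    (hi : i ∈ X) : y.2.1 i = x.2.1 i := by
  induction h with
  | refl => rfl
  | tail _ hyz ih =>
    obtain ⟨a, op, -, hc, -⟩ := hyz
    exact ((hc i).1 hi).trans ih

theorem Pumpable.reach {x y : Config k Q Γ} (hx : P.Pumpable X x) (h : P.FrozenReach X x y) :
    P.Pumpable X y := by
  induction h with
  | refl => exact hx
  | tail _ hyz ih => exact ih.step hyz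

/-- A path that never goes below the initial height of the stack does not depend on the initial
stack content. -/
theorem exists_relative_path {σ : ℕ → Config k Q Γ} (hσ : ∀ n, P.FrozenStep X (σ n) (σ (n + 1)))
    {i : ℕ} (hi : ∀ j ≥ i, (σ i).2.2.length ≤ (σ j).2.2.length) {j : ℕ} (hij : i ≤ j) :
    ∃ u, (σ j).2.2 = (σ i).2.2 ++ u ∧
      P.FrozenReach X ((σ i).1, (σ i).2.1, []) ((σ j).1, (σ j).2.1, u) := by
  induction j, hij using Nat.le_induction with
  | base => exact ⟨[], by simp, .refl⟩
  | succ j hij ih =>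
    obtain ⟨u, hu, hr⟩ := ih
    obtain ⟨a, op, ht, hc, hs⟩ := hσ j
    rw [hu] at hs
    obtain ⟨v, hv, hs'⟩ := hs.of_append (hi (j + 1) (by omega))
    exact ⟨v, hv, hr.tail ⟨a, op, ht, hc, hs'⟩⟩

/-- Freezing one more counter does not remove any reachable stack content. -/
theorem FrozenReach.insert {x y : Config k Q Γ} (h : P.FrozenReach X x y) (i : Fin k) :
    ∃ d, P.FrozenReach (insert i X) x (y.1, d, y.2.2) ∧ ∀ j ≠ i, d j = y.2.1 j := by
  classical
  induction h with
  | refl => exact ⟨x.2.1, .refl, fun _ _ => rfl⟩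
  | @tail y z _ hyz ih =>
    obtain ⟨d, hr, hd⟩ := ih
    obtain ⟨a, op, ht, hc, hs⟩ := hyz
    refine ⟨fun j => if j = i then d j else z.2.1 j, hr.tail ⟨a, op, ht, fun j => ⟨?_, ?_⟩, hs⟩,
      fun j hj => by simp [hj]⟩
    · intro hj
      by_cases hji : j = i
      · simp [hji]
      · simp [hji, hd j hji, (hc j).1 (hj.resolve_left hji)]
    · intro hj
      have hji : j ≠ i := fun h => hj (.inl h)
      have := (hc j).2 fun h => hj (.inr h)
      simpa [hji, hd j hji] using this

/-- Equality on a finite set of states times the order on `ℕ^k` is a well-quasi-order, by Dickson's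
lemma. Finiteness of `Q` itself is not needed: every state on the path after the first is the target
of one of the finitely many transitions. This is why only positive indices are extracted. -/
theorem exists_increasing_pair {σ : ℕ → Config k Q Γ}
    (hσ : ∀ n, P.FrozenStep X (σ n) (σ (n + 1))) {p : ℕ → Prop} (hp : ∀ N, ∃ i ≥ N, p i) :
    ∃ i j, i < j ∧ p i ∧ (σ i).1 = (σ j).1 ∧ (σ i).2.1 ≤ (σ j).2.1 := by
  classical
  obtain ⟨φ, hφ, hpφ⟩ := Filter.extraction_of_frequently_atTop
    (Filter.frequently_atTop.2 fun N => (hp (N + 1)).imp fun i hi => ⟨(Nat.le_succ N).trans hi.1, 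
      (⟨hi.2, Nat.pos_of_ne_zero (by have := hi.1; omega)⟩ : p i ∧ 0 < i)⟩)
  let T : Finset Q := P.Δ.image fun t => t.2.2.2
  have hT (n : ℕ) : (σ (φ n)).1 ∈ T := by
    obtain ⟨m, hm⟩ := Nat.exists_eq_succ_of_ne_zero (hpφ n).2.ne'
    obtain ⟨a, op, ht, -, -⟩ := hσ m
    rw [hm]
    exact Finset.mem_image.2 ⟨_, ht, rfl⟩
  have hwqo : WellQuasiOrdered fun x y : T × (Fin k → ℕ) => x.1 = y.1 ∧ x.2 ≤ y.2 :=
    (Finite.wellQuasiOrdered (· = ·)).prod wellQuasiOrdered_le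
  obtain ⟨m, n, hmn, h1, h2⟩ := hwqo fun n => (⟨(σ (φ n)).1, hT n⟩, (σ (φ n)).2.1)
  exact ⟨φ m, φ n, hφ hmn, (hpφ m).1, congrArg Subtype.val h1, h2⟩

theorem finite_stacks_of_pumpable (hP : ¬ P.StackPumpable) (n : ℕ) {x : Config k Q Γ}
    (hn : Xᶜ.ncard = n) (hx : P.Pumpable X x) :
    ((fun y : Config k Q Γ => y.2.2) '' {y | P.FrozenReach X x y}).Finite := by
  induction n using Nat.strong_induction_on generalizing X x with
  | _ n ih =>
    by_contra hinf
    obtain ⟨σ, h0, hinj, hσ, hσinf⟩ := exists_injective_path (finite_frozenStep P X) _ hinf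
    have hreach (n : ℕ) : P.FrozenReach X x (σ n) := by
      induction n with
      | zero => exact h0 ▸ .refl
      | succ n ih => exact ih.tail (hσ n)
    obtain ⟨i, j, hij, hi, hq, hc⟩ := exists_increasing_pair hσ
      (exists_forall_ge_le fun n => (σ n).2.2.length)
    obtain ⟨u, hu, hr⟩ := exists_relative_path hσ hi hij.le
    have hxi : P.Pumpable X ((σ i).1, (σ i).2.1, (σ i).2.2) := hx.reach (hreach i)
    rw [← hq] at hr
    have hu0 : u = [] := by
      by_contra hne
      exact hP ⟨X, _, _, _, _, u, hxi, hr, hc, hne⟩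
    subst hu0
    rw [List.append_nil] at hu
    -- State and stack agree at `i` and `j`, so a path without repetitions must have different
    -- counters there.
    have hne : (σ i).2.1 ≠ (σ j).2.1 := fun h =>
      hij.ne (hinj (Prod.ext hq (Prod.ext h hu.symm)))
    obtain ⟨l, hl⟩ := (Pi.lt_def.1 (lt_of_le_of_ne hc hne)).2
    have hlX : l ∉ X := fun h => hl.ne' (hr.frozen h)
    -- Freezing `l` as well leaves fewer unfrozen counters. By induction finitely many stacks follow
    -- `σ i` in that larger behaviour, contradicting that infinitely many follow it with only `X`
    -- frozen.
    refine hσinf i ((ih _ ?_ rfl (hxi.accel hr hc hl)).subset ?_)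
    · rw [← hn]
      refine Set.ncard_lt_ncard ?_ (Set.toFinite _)
      exact compl_lt_compl_iff_lt.2 (Set.ssubset_insert hlX)
    · rintro _ ⟨y, hy, rfl⟩
      obtain ⟨d, hd, -⟩ := FrozenReach.insert hy l
      exact ⟨_, hd, rfl⟩

end Completeness

theorem stackPumpable_iff (P : PVAS k Q Γ) : P.StackPumpable ↔ ¬ P.StackBounded := by
  refine ⟨fun h => h.not_stackBounded, fun h => ?_⟩
  by_contra hP
  refine h ((finite_stacks_of_pumpable hP _ rfl Pumpable.init).subset ?_)
  rintro w ⟨q, c, hw⟩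
  refine ⟨(q, c, w), ?_, rfl⟩
  change P.FrozenReach ∅ _ _
  rw [FrozenReach, frozenStep_empty]
  exact hw

end PVAS

/-! ### Inductive invariants certify boundedness -/

namespace PVAS

variable {k : ℕ} {Q Γ : Type*}

open Relation

/-- The minimal elements of `U` form an antichain, which is finite in a well-quasi-order;
well-foundedness puts one below each element of `U`. -/
theorem exists_finite_basis {α : Type*} [PartialOrder α] [WellQuasiOrderedLE α] (U : Set α) :
    ∃ B ⊆ U, B.Finite ∧ ∀ x ∈ U, ∃ b ∈ B, b ≤ x := by
  refine ⟨{x | Minimal (· ∈ U) x}, fun x hx => hx.prop,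
    WellQuasiOrderedLE.finite_of_isAntichain (setOfPred_minimal_antichain _), fun x hx => ?_⟩
  obtain ⟨b, hb, hbU⟩ := exists_minimal_le_of_wellFoundedLT (· ∈ U) x hx
  exact ⟨b, hbU, hb⟩

/-- A finite certificate of boundedness of the stack: the configurations `(q, c, w)` with `w ∈ W`
that do not dominate an element of `M` form an inductive invariant. -/
structure IsInvariant (P : PVAS k Q Γ) (W : List (List Γ)) (M : List (Config k Q Γ)) : Prop where
  init_mem : P.wInit ∈ W
  init_not_le : ∀ m ∈ M, m.1 = P.qInit → m.2.2 = P.wInit → ¬ m.2.1 ≤ P.cInit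
  step : ∀ t ∈ P.Δ, ∀ w ∈ W, ∀ w', StackStep t.2.2.1 w w' →
    (w' ∈ W ∧ ∀ m ∈ M, m.1 = t.2.2.2 → m.2.2 = w' → ∃ m' ∈ M, m'.1 = t.1 ∧ m'.2.2 = w ∧
      ∀ i, m'.2.1 i = 0 ∨ m'.2.1 i + t.2.1 i ≤ m.2.1 i) ∨
    ∃ m' ∈ M, m'.1 = t.1 ∧ m'.2.2 = w ∧ ∀ i, m'.2.1 i = 0 ∨ m'.2.1 i + t.2.1 i ≤ 0

/-- The condition `m' i = 0 ∨ m' i + a i ≤ m i` places `m'` below the truncated difference `m - a`,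
so a step into a configuration above `m` must start above `m'`, which the invariant excludes. In the
second alternative the zero vector replaces `m`: the transition cannot fire at all from `w` inside
the invariant. -/
theorem IsInvariant.stackBounded {P : PVAS k Q Γ} {W : List (List Γ)} {M : List (Config k Q Γ)}
    (h : P.IsInvariant W M) : P.StackBounded := by
  refine W.finite_toSet.subset ?_
  rintro w ⟨q, c, hr⟩
  have key (x : Config k Q Γ) (hx : ReflTransGen P.Step (P.qInit, P.cInit, P.wInit) x) :
      x.2.2 ∈ W ∧ ∀ m ∈ M, m.1 = x.1 → m.2.2 = x.2.2 → ¬ m.2.1 ≤ x.2.1 := by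
    induction hx with
    | refl => exact ⟨h.init_mem, h.init_not_le⟩
    | @tail x y _ hxy ih =>
      obtain ⟨a, op, ht, hc, hs⟩ := hxy
      rcases h.step _ ht _ ih.1 _ hs with ⟨hw, hM⟩ | ⟨m', hm', h1, h2, h3⟩
      · refine ⟨hw, fun m hm hq hwm hle => ?_⟩
        obtain ⟨m', hm', h1, h2, h3⟩ := hM m hm hq hwm
        refine ih.2 m' hm' h1 h2 fun i => ?_
        have := h3 i
        have := hc i
        have : m.2.1 i ≤ y.2.1 i := hle i
        simp only at *; omega
      · refine (ih.2 m' hm' h1 h2 fun i => ?_).elim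
        have := h3 i
        have := hc i
        simp only at *; omega
  exact (key _ hr).1

/-- The configurations that are not dominated by a reachable one. -/
def Uncoverable (P : PVAS k Q Γ) (x : Config k Q Γ) : Prop :=
  ∀ d, x.2.1 ≤ d → (x.1, d, x.2.2) ∉ P.reachSet

theorem StackBounded.exists_isInvariant {P : PVAS k Q Γ} (h : P.StackBounded) :
    ∃ W M, P.IsInvariant W M := by
  classical
  choose B hBU hBfin hB using fun p : Q × List Γ =>
    exists_finite_basis {c : Fin k → ℕ | P.Uncoverable (p.1, c, p.2)}
  let W₀ := {w : List Γ | ∃ (q : Q) (c : Fin k → ℕ), (q, c, w) ∈ P.reachSet}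
  -- Sources of transitions suffice, since the invariant only ever demands elements of `M` at such
  -- states; `Q` may be infinite.
  let S : Finset Q := P.Δ.image fun t => t.1
  let M₀ : Set (Config k Q Γ) := ⋃ p ∈ (S : Set Q) ×ˢ W₀, (fun c => (p.1, c, p.2)) '' B p
  have hM₀ : M₀.Finite := (S.finite_toSet.prod h).biUnion fun p _ => (hBfin p).image _
  have hunc {m : Config k Q Γ} (hm : m ∈ M₀) : P.Uncoverable m := by
    simp only [M₀, Set.mem_iUnion] at hm
    obtain ⟨p, -, c, hc, rfl⟩ := hm
    exact hBU p hc
  have hex {q : Q} {c : Fin k → ℕ} {w : List Γ} (hq : q ∈ S) (hw : w ∈ W₀)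
      (hu : P.Uncoverable (q, c, w)) : ∃ m ∈ M₀, m.1 = q ∧ m.2.2 = w ∧ m.2.1 ≤ c := by
    obtain ⟨b, hb, hbc⟩ := hB (q, w) c hu
    exact ⟨(q, b, w), Set.mem_biUnion (x := (q, w)) ⟨hq, hw⟩ ⟨b, hb, rfl⟩, rfl, rfl, hbc⟩
  have hpre {t : Q × (Fin k → ℤ) × StackOp Γ × Q} (ht : t ∈ P.Δ) {w w' : List Γ} (hw : w ∈ W₀)
      (hs : StackStep t.2.2.1 w w') {c : Fin k → ℕ} (hu : P.Uncoverable (t.2.2.2, c, w')) :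
      ∃ m ∈ M₀, m.1 = t.1 ∧ m.2.2 = w ∧ ∀ i, m.2.1 i = 0 ∨ m.2.1 i + t.2.1 i ≤ c i := by
    -- The truncated difference `c - a` is the least vector from which the transition leads to a
    -- vector above `c`, so covering it would cover `c`.
    have hu' : P.Uncoverable (t.1, (fun i => ((c i : ℤ) - t.2.1 i).toNat), w) := by
      intro d hd hr
      have hd' (i : Fin k) : ((c i : ℤ) - t.2.1 i).toNat ≤ d i := hd i
      refine hu (fun i => ((d i : ℤ) + t.2.1 i).toNat) (fun i => ?_)
        (ReflTransGen.tail hr ⟨t.2.1, t.2.2.1, ht, fun i => ?_, hs⟩)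
      · have := hd' i
        simp only; omega
      · have := hd' i
        simp only; omega
    obtain ⟨m, hm, h1, h2, h3⟩ := hex (Finset.mem_image_of_mem _ ht) hw hu'
    refine ⟨m, hm, h1, h2, fun i => ?_⟩
    have : m.2.1 i ≤ ((c i : ℤ) - t.2.1 i).toNat := h3 i
    omega
  have hfin : W₀.Finite := h
  have hW₀ (w : List Γ) : w ∈ hfin.toFinset.toList ↔ w ∈ W₀ := by
    rw [Finset.mem_toList, Set.Finite.mem_toFinset]
  refine ⟨hfin.toFinset.toList, hM₀.toFinset.toList, ⟨?_, ?_, ?_⟩⟩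
  · exact (hW₀ _).2 ⟨_, _, ReflTransGen.refl⟩
  · intro m hm hq hw hle
    rw [Finset.mem_toList, Set.Finite.mem_toFinset] at hm
    refine hunc hm _ hle ?_
    rw [hq, hw]
    exact ReflTransGen.refl
  · simp only [hW₀]
    simp only [Finset.mem_toList, Set.Finite.mem_toFinset]
    intro t ht w hw w' hs
    by_cases hw' : w' ∈ W₀
    · refine .inl ⟨hw', fun m hm hq hwm => hpre ht hw hs ?_⟩
      have := hunc hm
      rwa [← hq, ← hwm]
    · refine .inr ?_
      -- When `w'` is never reached, already the zero vector is uncoverable there.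
      obtain ⟨m, hm, h1, h2, h3⟩ := hpre ht hw hs (c := 0) fun d _ hr => hw' ⟨_, _, hr⟩
      exact ⟨m, hm, h1, h2, by simpa using h3⟩

theorem stackBounded_iff_exists_isInvariant (P : PVAS k Q Γ) :
    P.StackBounded ↔ ∃ W M, P.IsInvariant W M :=
  ⟨StackBounded.exists_isInvariant, fun ⟨_, _, h⟩ => h.stackBounded⟩

end PVAS

/-! ### Renaming states and stack symbols -/

namespace PVAS

variable {k : ℕ} {Q Γ Q' Γ' : Type*}

open Relation

section Map

protected theorem ext {P P' : PVAS k Q Γ} (hq : P.qInit = P'.qInit) (hc : P.cInit = P'.cInit)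
    (hw : P.wInit = P'.wInit) (hΔ : ∀ t, t ∈ P.Δ ↔ t ∈ P'.Δ) : P = P' := by
  have := Finset.ext hΔ
  cases P
  cases P'
  simp_all

/-- Renaming of the stack symbol of a stack operation. -/
def _root_.StackOp.map (f : Γ → Γ') : StackOp Γ → StackOp Γ'
  | .push γ => .push (f γ)
  | .pop γ => .pop (f γ)
  | .nop => .nop

/-- Renaming of the state and of the stack symbols of a configuration. -/
def Config.map (f : Q → Q') (g : Γ → Γ') (x : Config k Q Γ) : Config k Q' Γ' :=
  (f x.1, x.2.1, x.2.2.map g)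

open Classical in
/-- Renaming of the states and of the stack symbols of a PVAS. -/
noncomputable def map (P : PVAS k Q Γ) (f : Q → Q') (g : Γ → Γ') : PVAS k Q' Γ' where
  qInit := f P.qInit
  cInit := P.cInit
  wInit := P.wInit.map g
  Δ := P.Δ.image fun t => (f t.1, t.2.1, t.2.2.1.map g, f t.2.2.2)

theorem mem_map_Δ (P : PVAS k Q Γ) (f : Q → Q') (g : Γ → Γ')
    (t : Q' × (Fin k → ℤ) × StackOp Γ' × Q') : t ∈ (P.map f g).Δ ↔
      ∃ t' ∈ P.Δ, (f t'.1, t'.2.1, t'.2.2.1.map g, f t'.2.2.2) = t := by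
  simp [map]

theorem StackStep.map {op : StackOp Γ} {u v : List Γ} (h : StackStep op u v) (g : Γ → Γ') :
    StackStep (op.map g) (u.map g) (v.map g) := by
  cases op <;> simp_all [StackStep, StackOp.map]

theorem StackStep.exists_of_map {g : Γ → Γ'} (hg : g.Injective) {op : StackOp Γ} {u : List Γ}
    {v' : List Γ'} (h : StackStep (op.map g) (u.map g) v') :
    ∃ v, v.map g = v' ∧ StackStep op u v := by
  cases op with
  | push γ => exact ⟨u ++ [γ], by simpa [StackStep, StackOp.map] using h.symm, rfl⟩
  | nop => exact ⟨u, h, rfl⟩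
  | pop γ =>
    obtain ⟨v, l, rfl, hv, hl⟩ := List.map_eq_append_iff.1 (show u.map g = v' ++ [g γ] from h)
    obtain ⟨γ', rfl, hγ⟩ := List.map_eq_singleton_iff.1 hl
    exact ⟨v, hv, by rw [hg hγ]; rfl⟩

theorem Step.map {P : PVAS k Q Γ} {x y : Config k Q Γ} (h : P.Step x y) (f : Q → Q')
    (g : Γ → Γ') : (P.map f g).Step (x.map f g) (y.map f g) := by
  classical
  obtain ⟨a, op, ht, hc, hs⟩ := h
  exact ⟨a, op.map g, Finset.mem_image.2 ⟨_, ht, rfl⟩, hc, hs.map g⟩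

/-- Injectivity of `f` and `g` ensures that the image system cannot fire a transition whose original
had a different source state or popped symbol. -/
theorem Step.exists_of_map {P : PVAS k Q Γ} {f : Q → Q'} {g : Γ → Γ'} (hf : f.Injective)
    (hg : g.Injective) {x : Config k Q Γ} {y' : Config k Q' Γ'}
    (h : (P.map f g).Step (x.map f g) y') : ∃ y, y.map f g = y' ∧ P.Step x y := by
  classical
  obtain ⟨q', d, v'⟩ := y'
  obtain ⟨a, op', ht', hc, hs'⟩ := h
  obtain ⟨⟨p, a, op, q⟩, ht, he⟩ := Finset.mem_image.1 ht'
  simp only [Prod.mk.injEq] at he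
  obtain ⟨h1, rfl, rfl, rfl⟩ := he
  obtain rfl := hf h1
  obtain ⟨v, rfl, hs⟩ := StackStep.exists_of_map hg hs'
  exact ⟨(q, d, v), rfl, a, op, ht, hc, hs⟩

theorem reachSet_map (P : PVAS k Q Γ) {f : Q → Q'} {g : Γ → Γ'} (hf : f.Injective)
    (hg : g.Injective) : (P.map f g).reachSet = Config.map f g '' P.reachSet := by
  ext y'
  constructor
  · intro h
    change ReflTransGen _ _ _ at h
    induction h with
    | refl => exact ⟨_, .refl, rfl⟩
    | tail _ hyz ih =>
      obtain ⟨y, hy, rfl⟩ := ih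
      obtain ⟨z, hz, hyz⟩ := hyz.exists_of_map hf hg
      exact ⟨z, ReflTransGen.tail hy hyz, hz⟩
  · rintro ⟨y, hy, rfl⟩
    exact ReflTransGen.lift (Config.map f g) (fun _ _ h => h.map f g) _ _ hy

theorem stackBounded_map (P : PVAS k Q Γ) {f : Q → Q'} {g : Γ → Γ'} (hf : f.Injective)
    (hg : g.Injective) : (P.map f g).StackBounded ↔ P.StackBounded := by
  unfold StackBounded
  rw [← Set.finite_image_iff (f := List.map g)
    (s := {w : List Γ | ∃ (q : Q) (c : Fin k → ℕ), (q, c, w) ∈ P.reachSet})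
    (List.map_injective_iff.2 hg).injOn, reachSet_map P hf hg]
  refine iff_of_eq (congrArg Set.Finite ?_)
  ext w
  constructor
  · rintro ⟨_, _, ⟨q, c, v⟩, h, he⟩
    exact ⟨v, ⟨q, c, h⟩, congrArg (fun x => x.2.2) he⟩
  · rintro ⟨v, ⟨q, c, h⟩, rfl⟩
    exact ⟨f q, c, (q, c, v), h, rfl⟩

end Map

/-! ### Decoding a code into a PVAS over the natural numbers -/

section Decode

/-- The vector of dimension `k` listed by `l`, filled up with zeros. -/
def decodeVec {α : Type*} [Zero α] (k : ℕ) (l : List α) : Fin k → α := fun i => l.getD i 0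

/-- The stack operation with a given code. -/
def decodeOp : Option (ℕ ⊕ ℕ) → StackOp ℕ
  | none => .nop
  | some (.inl γ) => .push γ
  | some (.inr γ) => .pop γ

/-- The configuration with counters listed by the second component of `s`. -/
def decodeConfig (k : ℕ) (s : ℕ × List ℕ × List ℕ) : Config k ℕ ℕ := (s.1, decodeVec k s.2.1, s.2.2)

/-- The transition with a given code. -/
def decodeTrans (k : ℕ) (t : TransCode) : ℕ × (Fin k → ℤ) × StackOp ℕ × ℕ :=
  (t.1, decodeVec k t.2.1, decodeOp t.2.2.1, t.2.2.2)

namespace Code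

/-- The initial configuration of a code. -/
def init (x : Code) : ℕ × List ℕ × List ℕ := (x.2.2.2.1, x.2.2.2.2.1, x.2.2.2.2.2.1)

/-- The transitions of a code. -/
def trans (x : Code) : List TransCode := x.2.2.2.2.2.2

open Classical in
/-- The PVAS with a given code, with natural numbers as states and as stack symbols. -/
noncomputable def toPVAS (x : Code) : PVAS x.1 ℕ ℕ where
  qInit := x.init.1
  cInit := decodeVec x.1 x.init.2.1
  wInit := x.init.2.2
  Δ := (x.trans.map (decodeTrans x.1)).toFinset

theorem mem_toPVAS_Δ (x : Code) (t : ℕ × (Fin x.1 → ℤ) × StackOp ℕ × ℕ) :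
    t ∈ x.toPVAS.Δ ↔ ∃ t' ∈ x.trans, decodeTrans x.1 t' = t := by
  simp [toPVAS]

end Code

theorem decodeVec_ofFn {α : Type*} [Zero α] (v : Fin k → α) : decodeVec k (List.ofFn v) = v := by
  funext i
  simp [decodeVec]

theorem decodeConfig_surjective : Function.Surjective (decodeConfig k) := fun x =>
  ⟨(x.1, List.ofFn x.2.1, x.2.2), by simp [decodeConfig, decodeVec_ofFn]⟩

/-- Decoding forgets the order and repetitions in `ts` and recovers `P` up to injective renaming,
which does not affect stack-boundedness. -/
theorem toPVAS_code {n m : ℕ} (P : PVAS k Q Γ) (eQ : Q ≃ Fin n) (eΓ : Γ ≃ Fin m)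
    (ts : List (Q × (Fin k → ℤ) × StackOp Γ × Q)) (hts : ∀ t, t ∈ ts ↔ t ∈ P.Δ) :
    (P.code eQ eΓ ts).toPVAS = P.map (fun q => (eQ q : ℕ)) (fun γ => (eΓ γ : ℕ)) := by
  classical
  have hop (op : StackOp Γ) : decodeOp (opCode eΓ op) = op.map fun γ => (eΓ γ : ℕ) := by
    cases op <;> rfl
  refine PVAS.ext rfl (decodeVec_ofFn _) rfl fun t => ?_
  refine (Code.mem_toPVAS_Δ (P.code eQ eΓ ts) t).trans (Iff.trans ?_ (mem_map_Δ _ _ _ _).symm)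
  simp only [Code.trans, code, List.mem_map, exists_exists_and_eq_and, hts]
  refine exists_congr fun t' => and_congr_right fun _ => ?_
  simp [decodeTrans, transCode, decodeVec_ofFn, hop]

theorem stackBounded_toPVAS_code {n m : ℕ} (P : PVAS k Q Γ) (eQ : Q ≃ Fin n) (eΓ : Γ ≃ Fin m)
    (ts : List (Q × (Fin k → ℤ) × StackOp Γ × Q)) (hts : ∀ t, t ∈ ts ↔ t ∈ P.Δ) :
    (P.code eQ eΓ ts).toPVAS.StackBounded ↔ P.StackBounded := by
  rw [toPVAS_code P eQ eΓ ts hts]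
  exact P.stackBounded_map (Fin.val_injective.comp eQ.injective)
    (Fin.val_injective.comp eΓ.injective)

end Decode

/-! ### Primitive recursive tools for lists, integers and stack steps -/

section Primrec

variable {α β : Type*} [Primcodable α] [Primcodable β]

theorem _root_.PrimrecPred.exists_mem {f : α → List β} (hf : Primrec f) {R : α → β → Prop}
    (hR : PrimrecPred fun p : α × β => R p.1 p.2) : PrimrecPred fun a => ∃ b ∈ f a, R a b :=
  (PrimrecRel.exists_mem_list (R := fun b a => R a b) (hR.primrecRel.swap)).comp hf Primrec.id

theorem _root_.PrimrecPred.forall_mem {f : α → List β} (hf : Primrec f) {R : α → β → Prop}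
    (hR : PrimrecPred fun p : α × β => R p.1 p.2) : PrimrecPred fun a => ∀ b ∈ f a, R a b :=
  (PrimrecRel.forall_mem_list (R := fun b a => R a b) (hR.primrecRel.swap)).comp hf Primrec.id

theorem _root_.PrimrecPred.forall_lt' {f : α → ℕ} (hf : Primrec f) {R : α → ℕ → Prop}
    (hR : PrimrecPred fun p : α × ℕ => R p.1 p.2) : PrimrecPred fun a => ∀ i < f a, R a i :=
  (PrimrecPred.forall_mem (Primrec.list_range.comp hf) hR).of_eq fun a => by simp

theorem _root_.PrimrecPred.mem [DecidableEq β] {f : α → List β} (hf : Primrec f) {g : α → β}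
    (hg : Primrec g) : PrimrecPred fun a => g a ∈ f a :=
  (PrimrecPred.exists_mem hf (R := fun a b => b = g a)
    (Primrec.eq.comp Primrec.snd (hg.comp Primrec.fst))).of_eq fun a => by simp

/-- Integers are encoded with `n ≥ 0` as `2 * n` and `-(n + 1)` as `2 * n + 1`, so parity reveals
the sign. -/
theorem primrec_int_toNat : Primrec Int.toNat := by
  refine (Primrec.ite (c := fun a : ℤ => Encodable.encode a % 2 = 0)
    (Primrec.eq.comp (Primrec.nat_mod.comp Primrec.encode (Primrec.const 2)) (Primrec.const 0))
    (Primrec.nat_div.comp Primrec.encode (Primrec.const 2)) (Primrec.const 0)).of_eq fun a => ?_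
  cases a with
  | ofNat n =>
    have : Encodable.encode (Int.ofNat n) = 2 * n := rfl
    rw [this, if_pos (by omega)]
    simp
  | negSucc n =>
    have : Encodable.encode (Int.negSucc n) = 2 * n + 1 := rfl
    rw [this, if_neg (by omega)]
    rfl

theorem primrec_int_neg_toNat : Primrec fun a : ℤ => (-a).toNat := by
  refine (Primrec.ite (c := fun a : ℤ => Encodable.encode a % 2 = 0)
    (Primrec.eq.comp (Primrec.nat_mod.comp Primrec.encode (Primrec.const 2)) (Primrec.const 0))
    (Primrec.const 0) (Primrec.succ.comp (Primrec.nat_div.comp Primrec.encode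
      (Primrec.const 2)))).of_eq fun a => ?_
  cases a with
  | ofNat n =>
    have : Encodable.encode (Int.ofNat n) = 2 * n := rfl
    rw [this, if_pos (by omega)]
    simp
  | negSucc n =>
    have : Encodable.encode (Int.negSucc n) = 2 * n + 1 := rfl
    rw [this, if_neg (by omega), Int.neg_negSucc]
    simp only [Int.toNat_natCast]
    omega

/-- Moving the negative part of `a` to the other side turns this into a comparison of natural
numbers. -/
theorem primrecPred_add_le {m n : α → ℕ} {a : α → ℤ} (hm : Primrec m) (hn : Primrec n)
    (ha : Primrec a) : PrimrecPred fun z => (m z : ℤ) + a z ≤ n z :=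
  (Primrec.nat_le.comp (Primrec.nat_add.comp hm (primrec_int_toNat.comp ha))
    (Primrec.nat_add.comp hn (primrec_int_neg_toNat.comp ha))).of_eq fun z => by omega

theorem primrecPred_eq_add {m n : α → ℕ} {a : α → ℤ} (hm : Primrec m) (hn : Primrec n)
    (ha : Primrec a) : PrimrecPred fun z => (n z : ℤ) = (m z : ℤ) + a z :=
  (Primrec.eq.comp (Primrec.nat_add.comp hn (primrec_int_neg_toNat.comp ha))
    (Primrec.nat_add.comp hm (primrec_int_toNat.comp ha))).of_eq fun z => by omega

/-- The stack symbol in the code of a stack operation. -/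
def opSymbol (o : Option (ℕ ⊕ ℕ)) : ℕ := o.elim 0 (Sum.elim id id)

theorem primrec_opSymbol : Primrec opSymbol := by
  refine (Primrec.option_casesOn (o := id) (f := fun _ => 0)
    (g := fun _ (s : ℕ ⊕ ℕ) => Sum.casesOn s id id) Primrec.id (Primrec.const 0)
    (Primrec.sumCasesOn (f := Prod.snd) (g := fun _ x => x) (h := fun _ x => x) Primrec.snd
      Primrec.snd Primrec.snd).to₂).of_eq fun o => ?_
  rcases o with _ | _ | _ <;> rfl

theorem stackStep_decodeOp_iff (o : Option (ℕ ⊕ ℕ)) (u v : List ℕ) :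
    StackStep (decodeOp o) u v ↔ (o = none ∧ u = v) ∨
      (o = some (.inl (opSymbol o)) ∧ v = u ++ [opSymbol o]) ∨
      (o = some (.inr (opSymbol o)) ∧ u = v ++ [opSymbol o]) := by
  rcases o with _ | _ | _ <;> simp [decodeOp, StackStep, opSymbol]

theorem primrecPred_stackStep {o : α → Option (ℕ ⊕ ℕ)} {u v : α → List ℕ} (ho : Primrec o)
    (hu : Primrec u) (hv : Primrec v) :
    PrimrecPred fun a => StackStep (decodeOp (o a)) (u a) (v a) := by
  have hs := primrec_opSymbol.comp ho
  exact ((Primrec.eq.comp ho (Primrec.const none)).and (Primrec.eq.comp hu hv)).or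
    (((Primrec.eq.comp ho (Primrec.option_some.comp (Primrec.sumInl.comp hs))).and
      (Primrec.eq.comp hv (Primrec.list_concat.comp hu hs))).or
    ((Primrec.eq.comp ho (Primrec.option_some.comp (Primrec.sumInr.comp hs))).and
      (Primrec.eq.comp hu (Primrec.list_concat.comp hv hs)))) |>.of_eq
    fun a => (stackStep_decodeOp_iff _ _ _).symm

end Primrec

end PVAS

/-! ### Checking steps and invariants on codes -/

namespace PVAS

open Relation

section Explicit

namespace Code

theorem frozenStep_toPVAS_iff (x : Code) (X : List ℕ) (s t : ℕ × List ℕ × List ℕ) :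
    x.toPVAS.FrozenStep {i | (i : ℕ) ∈ X} (decodeConfig x.1 s) (decodeConfig x.1 t) ↔
      ∃ e ∈ x.trans, (e.1 = s.1 ∧ e.2.2.2 = t.1) ∧
        (∀ i < x.1, (i ∈ X ∧ t.2.1.getD i 0 = s.2.1.getD i 0) ∨
          (i ∉ X ∧ (t.2.1.getD i 0 : ℤ) = (s.2.1.getD i 0 : ℤ) + e.2.1.getD i 0)) ∧
        StackStep (decodeOp e.2.2.1) s.2.2 t.2.2 := by
  have hc (a : Fin x.1 → ℤ) (i : Fin x.1) :
      ((i ∈ {i : Fin x.1 | (i : ℕ) ∈ X} → decodeVec x.1 t.2.1 i = decodeVec x.1 s.2.1 i) ∧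
        (i ∉ {i : Fin x.1 | (i : ℕ) ∈ X} →
          ((decodeVec x.1 t.2.1 i : ℕ) : ℤ) = (decodeVec x.1 s.2.1 i : ℕ) + a i)) ↔
      (((i : ℕ) ∈ X ∧ t.2.1.getD i 0 = s.2.1.getD i 0) ∨
          ((i : ℕ) ∉ X ∧ (t.2.1.getD i 0 : ℤ) = (s.2.1.getD i 0 : ℤ) + a i)) := by
    change (((i : ℕ) ∈ X → t.2.1.getD i 0 = s.2.1.getD i 0) ∧ ((i : ℕ) ∉ X → _ = _)) ↔ _
    by_cases h : (i : ℕ) ∈ X <;> simp [h, decodeVec]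
  constructor
  · rintro ⟨a, op, ht, h, hs⟩
    obtain ⟨e, he, heq⟩ := (x.mem_toPVAS_Δ _).1 ht
    simp only [decodeTrans, Prod.mk.injEq] at heq
    obtain ⟨h1, rfl, rfl, h4⟩ := heq
    exact ⟨e, he, ⟨h1, h4⟩, fun i hi => (hc _ ⟨i, hi⟩).1 (h ⟨i, hi⟩), hs⟩
  · rintro ⟨e, he, ⟨h1, h4⟩, h, hs⟩
    refine ⟨decodeVec x.1 e.2.1, decodeOp e.2.2.1, (x.mem_toPVAS_Δ _).2 ⟨e, he, ?_⟩,
      fun i => (hc _ i).2 (h i i.2), hs⟩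
    simp [decodeTrans, decodeConfig, h1, h4]

theorem decodeVec_le_iff {k : ℕ} (l l' : List ℕ) :
    decodeVec k l ≤ decodeVec k l' ↔ ∀ i < k, l.getD i 0 ≤ l'.getD i 0 :=
  Fin.forall_iff

/-- Every quantifier on the right is bounded by a list or a number, which makes the test primitive
recursive. The unbounded `w'` is replaced by the only three possible results of `nop`, `push` and
`pop`. -/
theorem isInvariant_toPVAS_iff (x : Code) (W : List (List ℕ)) (M : List (ℕ × List ℕ × List ℕ)) :
    x.toPVAS.IsInvariant W (M.map (decodeConfig x.1)) ↔
      x.init.2.2 ∈ W ∧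
      (∀ m ∈ M, ¬ ((m.1 = x.init.1 ∧ m.2.2 = x.init.2.2) ∧
        ∀ i < x.1, m.2.1.getD i 0 ≤ x.init.2.1.getD i 0)) ∧
      ∀ e ∈ x.trans, ∀ w ∈ W,
        ∀ w' ∈ [w, w ++ [opSymbol e.2.2.1], w.reverse.tail.reverse],
          ¬ StackStep (decodeOp e.2.2.1) w w' ∨
          (w' ∈ W ∧ ∀ m ∈ M, ¬ (m.1 = e.2.2.2 ∧ m.2.2 = w') ∨
            ∃ m' ∈ M, (m'.1 = e.1 ∧ m'.2.2 = w) ∧ ∀ i < x.1, m'.2.1.getD i 0 = 0 ∨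
              (m'.2.1.getD i 0 : ℤ) + e.2.1.getD i 0 ≤ m.2.1.getD i 0) ∨
          ∃ m' ∈ M, (m'.1 = e.1 ∧ m'.2.2 = w) ∧ ∀ i < x.1, m'.2.1.getD i 0 = 0 ∨
            (m'.2.1.getD i 0 : ℤ) + e.2.1.getD i 0 ≤ (0 : ℕ) := by
  have hcand {o : Option (ℕ ⊕ ℕ)} {w w' : List ℕ} (h : StackStep (decodeOp o) w w') :
      w' ∈ [w, w ++ [opSymbol o], w.reverse.tail.reverse] := by
    rcases (stackStep_decodeOp_iff _ _ _).1 h with ⟨-, rfl⟩ | ⟨-, rfl⟩ | ⟨-, rfl⟩ <;> simp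
  have hall (φ : Fin x.1 → Prop) : (∀ i, φ i) ↔ ∀ i (h : i < x.1), φ ⟨i, h⟩ := Fin.forall_iff
  constructor
  · rintro ⟨h1, h2, h3⟩
    refine ⟨h1, ?_, ?_⟩
    · rintro m hm ⟨⟨hq, hw⟩, hc⟩
      exact h2 _ (List.mem_map_of_mem hm) hq hw fun i => hc i i.2
    · intro e he w hw w' _
      by_cases hs : StackStep (decodeOp e.2.2.1) w w'
      swap
      · exact .inl hs
      refine .inr ?_
      rcases h3 _ ((x.mem_toPVAS_Δ _).2 ⟨e, he, rfl⟩) w hw w' hs with ⟨hw', h⟩ | ⟨m', hm', h4, h5, h6⟩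
      · refine .inl ⟨hw', fun m hm => ?_⟩
        by_cases hq : m.1 = e.2.2.2 ∧ m.2.2 = w'
        swap
        · exact .inl hq
        obtain ⟨m', hm', h4, h5, h6⟩ := h _ (List.mem_map_of_mem hm) hq.1 hq.2
        obtain ⟨m'', hm'', rfl⟩ := List.mem_map.1 hm'
        exact .inr ⟨m'', hm'', ⟨h4, h5⟩, fun i hi => h6 ⟨i, hi⟩⟩
      · obtain ⟨m'', hm'', rfl⟩ := List.mem_map.1 hm'
        exact .inr ⟨m'', hm'', ⟨h4, h5⟩, fun i hi => h6 ⟨i, hi⟩⟩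
  · rintro ⟨h1, h2, h3⟩
    refine ⟨h1, ?_, ?_⟩
    · intro m hm hq hw hc
      obtain ⟨s, hs, rfl⟩ := List.mem_map.1 hm
      exact h2 s hs ⟨⟨hq, hw⟩, fun i hi => hc ⟨i, hi⟩⟩
    · intro t ht w hw w' hs
      obtain ⟨e, he, rfl⟩ := (x.mem_toPVAS_Δ _).1 ht
      rcases h3 e he w hw w' (hcand hs) with h | ⟨hw', h⟩ | ⟨m', hm', ⟨h4, h5⟩, h6⟩
      · exact (h hs).elim
      · refine .inl ⟨hw', fun m hm hq hwm => ?_⟩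
        obtain ⟨s, hms, rfl⟩ := List.mem_map.1 hm
        rcases h s hms with h | ⟨m', hm', ⟨h4, h5⟩, h6⟩
        · exact (h ⟨hq, hwm⟩).elim
        · exact ⟨_, List.mem_map_of_mem hm', h4, h5, fun i => h6 i i.2⟩
      · exact .inr ⟨_, List.mem_map_of_mem hm', h4, h5, fun i => h6 i i.2⟩

end Code

end Explicit

section Primrec

namespace Code

variable {α : Type*} [Primcodable α]

theorem primrec_init : Primrec Code.init := by
  have h : Primrec fun x : Code => x.2.2.2 := Primrec.snd.comp (Primrec.snd.comp Primrec.snd)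
  exact Primrec.pair (Primrec.fst.comp h) (Primrec.pair (Primrec.fst.comp (Primrec.snd.comp h))
    (Primrec.fst.comp (Primrec.snd.comp (Primrec.snd.comp h))))

theorem primrec_trans : Primrec Code.trans :=
  Primrec.snd.comp (Primrec.snd.comp (Primrec.snd.comp
    (Primrec.snd.comp (Primrec.snd.comp Primrec.snd))))

theorem primrec_dim : Primrec fun x : Code => x.1 := Primrec.fst

theorem primrecPred_frozenStep {x : α → Code} {X : α → List ℕ} {s t : α → ℕ × List ℕ × List ℕ}
    (hx : Primrec x) (hX : Primrec X) (hs : Primrec s) (ht : Primrec t) :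
    PrimrecPred fun a => (x a).toPVAS.FrozenStep {i | (i : ℕ) ∈ X a} (decodeConfig (x a).1 (s a))
      (decodeConfig (x a).1 (t a)) := by
  refine PrimrecPred.of_eq ?_ fun a => (frozenStep_toPVAS_iff (x a) (X a) (s a) (t a)).symm
  have hs' : Primrec fun p : α × TransCode => s p.1 := hs.comp Primrec.fst
  have ht' : Primrec fun p : α × TransCode => t p.1 := ht.comp Primrec.fst
  refine PrimrecPred.exists_mem (primrec_trans.comp hx) (PrimrecPred.and (PrimrecPred.and
    (Primrec.eq.comp (Primrec.fst.comp Primrec.snd) (Primrec.fst.comp hs'))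
    (Primrec.eq.comp (Primrec.snd.comp (Primrec.snd.comp (Primrec.snd.comp Primrec.snd)))
      (Primrec.fst.comp ht'))) (PrimrecPred.and ?_ ?_))
  · refine PrimrecPred.forall_lt' (primrec_dim.comp (hx.comp Primrec.fst)) ?_
    have hi : Primrec fun p : (α × TransCode) × ℕ => p.2 := Primrec.snd
    have hsi : Primrec fun p : (α × TransCode) × ℕ => (s p.1.1).2.1.getD p.2 0 :=
      (Primrec.list_getD 0).comp (Primrec.fst.comp (Primrec.snd.comp (hs'.comp Primrec.fst))) hi
    have hti : Primrec fun p : (α × TransCode) × ℕ => (t p.1.1).2.1.getD p.2 0 :=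
      (Primrec.list_getD 0).comp (Primrec.fst.comp (Primrec.snd.comp (ht'.comp Primrec.fst))) hi
    have hei : Primrec fun p : (α × TransCode) × ℕ => p.1.2.2.1.getD p.2 0 :=
      (Primrec.list_getD 0).comp
        (Primrec.fst.comp (Primrec.snd.comp (Primrec.snd.comp Primrec.fst))) hi
    have hmem : PrimrecPred fun p : (α × TransCode) × ℕ => p.2 ∈ X p.1.1 :=
      PrimrecPred.mem (hX.comp (Primrec.fst.comp Primrec.fst)) hi
    exact (hmem.and (Primrec.eq.comp hti hsi)).or (hmem.not.and (primrecPred_eq_add hsi hti hei))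
  · exact primrecPred_stackStep
      (Primrec.fst.comp (Primrec.snd.comp (Primrec.snd.comp Primrec.snd)))
      (Primrec.snd.comp (Primrec.snd.comp hs')) (Primrec.snd.comp (Primrec.snd.comp ht'))

theorem primrecPred_decodeVec_le {n : α → ℕ} {l l' : α → List ℕ} (hn : Primrec n)
    (hl : Primrec l) (hl' : Primrec l') :
    PrimrecPred fun a => decodeVec (n a) (l a) ≤ decodeVec (n a) (l' a) := by
  refine PrimrecPred.of_eq ?_ fun a => (decodeVec_le_iff _ _).symm
  exact PrimrecPred.forall_lt' hn (Primrec.nat_le.comp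
    ((Primrec.list_getD 0).comp (hl.comp Primrec.fst) Primrec.snd)
    ((Primrec.list_getD 0).comp (hl'.comp Primrec.fst) Primrec.snd))

theorem primrecPred_exists_pre {n : α → ℕ} {e : α → TransCode} {w : α → List ℕ}
    {M : α → List (ℕ × List ℕ × List ℕ)} {c : α → ℕ → ℕ} (hn : Primrec n) (he : Primrec e)
    (hw : Primrec w) (hM : Primrec M) (hc : Primrec₂ c) :
    PrimrecPred fun a => ∃ m' ∈ M a, (m'.1 = (e a).1 ∧ m'.2.2 = w a) ∧
      ∀ i < n a, m'.2.1.getD i 0 = 0 ∨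
        (m'.2.1.getD i 0 : ℤ) + (e a).2.1.getD i 0 ≤ c a i := by
  refine PrimrecPred.exists_mem hM (PrimrecPred.and (PrimrecPred.and
    (Primrec.eq.comp (Primrec.fst.comp Primrec.snd) (Primrec.fst.comp (he.comp Primrec.fst)))
    (Primrec.eq.comp (Primrec.snd.comp (Primrec.snd.comp Primrec.snd)) (hw.comp Primrec.fst)))
    (PrimrecPred.forall_lt' (hn.comp Primrec.fst) ?_))
  have hm : Primrec fun p : (α × ℕ × List ℕ × List ℕ) × ℕ => p.1.2.2.1.getD p.2 0 :=
    (Primrec.list_getD 0).comp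
      (Primrec.fst.comp (Primrec.snd.comp (Primrec.snd.comp Primrec.fst))) Primrec.snd
  refine PrimrecPred.or (Primrec.eq.comp hm (Primrec.const 0)) (primrecPred_add_le hm ?_ ?_)
  · exact hc.comp (Primrec.fst.comp Primrec.fst) Primrec.snd
  · exact (Primrec.list_getD 0).comp (Primrec.fst.comp (Primrec.snd.comp
      (he.comp (Primrec.fst.comp Primrec.fst)))) Primrec.snd

theorem primrecPred_transition {n : α → ℕ} {W : α → List (List ℕ)}
    {M : α → List (ℕ × List ℕ × List ℕ)} {e : α → TransCode} {w w' : α → List ℕ} (hn : Primrec n)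
    (hW : Primrec W) (hM : Primrec M) (he : Primrec e) (hw : Primrec w) (hw' : Primrec w') :
    PrimrecPred fun a => ¬ StackStep (decodeOp (e a).2.2.1) (w a) (w' a) ∨
      (w' a ∈ W a ∧ ∀ m ∈ M a, ¬ (m.1 = (e a).2.2.2 ∧ m.2.2 = w' a) ∨
        ∃ m' ∈ M a, (m'.1 = (e a).1 ∧ m'.2.2 = w a) ∧ ∀ i < n a, m'.2.1.getD i 0 = 0 ∨
          (m'.2.1.getD i 0 : ℤ) + (e a).2.1.getD i 0 ≤ m.2.1.getD i 0) ∨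
      ∃ m' ∈ M a, (m'.1 = (e a).1 ∧ m'.2.2 = w a) ∧ ∀ i < n a, m'.2.1.getD i 0 = 0 ∨
        (m'.2.1.getD i 0 : ℤ) + (e a).2.1.getD i 0 ≤ (0 : ℕ) := by
  have hf : Primrec fun p : α × ℕ × List ℕ × List ℕ => p.1 := Primrec.fst
  have hm : Primrec fun p : α × ℕ × List ℕ × List ℕ => p.2 := Primrec.snd
  have hpre : PrimrecPred fun p : α × ℕ × List ℕ × List ℕ =>
      ∃ m' ∈ M p.1, (m'.1 = (e p.1).1 ∧ m'.2.2 = w p.1) ∧ ∀ i < n p.1, m'.2.1.getD i 0 = 0 ∨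
        (m'.2.1.getD i 0 : ℤ) + (e p.1).2.1.getD i 0 ≤ p.2.2.1.getD i 0 :=
    primrecPred_exists_pre (c := fun p i => p.2.2.1.getD i 0) (hn.comp hf) (he.comp hf)
      (hw.comp hf) (hM.comp hf) ((Primrec.list_getD 0).comp
        (Primrec.fst.comp (Primrec.snd.comp (hm.comp Primrec.fst))) Primrec.snd).to₂
  have hpre' : PrimrecPred fun a =>
      ∃ m' ∈ M a, (m'.1 = (e a).1 ∧ m'.2.2 = w a) ∧ ∀ i < n a, m'.2.1.getD i 0 = 0 ∨
        (m'.2.1.getD i 0 : ℤ) + (e a).2.1.getD i 0 ≤ (0 : ℕ) :=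
    primrecPred_exists_pre (c := fun _ _ => 0) hn he hw hM (Primrec.const 0)
  have htgt : PrimrecPred fun p : α × ℕ × List ℕ × List ℕ =>
      p.2.1 = (e p.1).2.2.2 ∧ p.2.2.2 = w' p.1 :=
    (Primrec.eq.comp (Primrec.fst.comp hm)
      (Primrec.snd.comp (Primrec.snd.comp (Primrec.snd.comp (he.comp hf))))).and
    (Primrec.eq.comp (Primrec.snd.comp (Primrec.snd.comp hm)) (hw'.comp hf))
  have hstack := primrecPred_stackStep (Primrec.fst.comp (Primrec.snd.comp (Primrec.snd.comp he)))
    hw hw'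
  exact hstack.not.or (((PrimrecPred.mem hW hw').and
    (PrimrecPred.forall_mem hM (htgt.not.or hpre))).or hpre')

theorem primrecPred_transitions {n : α → ℕ} {l : α → List TransCode} {W : α → List (List ℕ)}
    {M : α → List (ℕ × List ℕ × List ℕ)} (hn : Primrec n) (hl : Primrec l) (hW : Primrec W)
    (hM : Primrec M) : PrimrecPred fun a => ∀ e ∈ l a, ∀ w ∈ W a,
      ∀ w' ∈ [w, w ++ [opSymbol e.2.2.1], w.reverse.tail.reverse],
        ¬ StackStep (decodeOp e.2.2.1) w w' ∨
        (w' ∈ W a ∧ ∀ m ∈ M a, ¬ (m.1 = e.2.2.2 ∧ m.2.2 = w') ∨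
          ∃ m' ∈ M a, (m'.1 = e.1 ∧ m'.2.2 = w) ∧ ∀ i < n a, m'.2.1.getD i 0 = 0 ∨
            (m'.2.1.getD i 0 : ℤ) + e.2.1.getD i 0 ≤ m.2.1.getD i 0) ∨
        ∃ m' ∈ M a, (m'.1 = e.1 ∧ m'.2.2 = w) ∧ ∀ i < n a, m'.2.1.getD i 0 = 0 ∨
          (m'.2.1.getD i 0 : ℤ) + e.2.1.getD i 0 ≤ (0 : ℕ) := by
  have ha : Primrec fun p : ((α × TransCode) × List ℕ) × List ℕ => p.1.1.1 :=
    Primrec.fst.comp (Primrec.fst.comp Primrec.fst)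
  have he : Primrec fun p : (α × TransCode) × List ℕ => p.1.2 := Primrec.snd.comp Primrec.fst
  have hw : Primrec fun p : (α × TransCode) × List ℕ => p.2 := Primrec.snd
  have ho : Primrec fun p : (α × TransCode) × List ℕ => p.1.2.2.2.1 :=
    Primrec.fst.comp (Primrec.snd.comp (Primrec.snd.comp he))
  have hcand : Primrec fun p : (α × TransCode) × List ℕ =>
      [p.2, p.2 ++ [opSymbol p.1.2.2.2.1], p.2.reverse.tail.reverse] :=
    Primrec.list_cons.comp hw (Primrec.list_cons.comp
      (Primrec.list_concat.comp hw (primrec_opSymbol.comp ho)) (Primrec.list_cons.comp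
        (Primrec.list_reverse.comp (Primrec.list_tail.comp (Primrec.list_reverse.comp hw)))
        (Primrec.const [])))
  refine PrimrecPred.forall_mem hl (PrimrecPred.forall_mem (hW.comp Primrec.fst)
    (PrimrecPred.forall_mem hcand ?_))
  exact primrecPred_transition (hn.comp ha) (hW.comp ha) (hM.comp ha) (he.comp Primrec.fst)
    (hw.comp Primrec.fst) Primrec.snd

theorem primrecPred_isInvariant : PrimrecPred
    fun p : Code × List (List ℕ) × List (ℕ × List ℕ × List ℕ) =>
      p.1.toPVAS.IsInvariant p.2.1 (p.2.2.map (decodeConfig p.1.1)) := by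
  refine PrimrecPred.of_eq ?_ fun p => (isInvariant_toPVAS_iff p.1 p.2.1 p.2.2).symm
  have hx : Primrec fun p : Code × List (List ℕ) × List (ℕ × List ℕ × List ℕ) => p.1 := Primrec.fst
  have hW : Primrec fun p : Code × List (List ℕ) × List (ℕ × List ℕ × List ℕ) => p.2.1 :=
    Primrec.fst.comp Primrec.snd
  have hM : Primrec fun p : Code × List (List ℕ) × List (ℕ × List ℕ × List ℕ) => p.2.2 :=
    Primrec.snd.comp Primrec.snd
  have hi := primrec_init.comp hx
  refine (PrimrecPred.mem hW (Primrec.snd.comp (Primrec.snd.comp hi))).and (PrimrecPred.and ?_ ?_)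
  · have hi' := hi.comp (Primrec.fst (β := ℕ × List ℕ × List ℕ))
    refine PrimrecPred.forall_mem hM (PrimrecPred.not (PrimrecPred.and (PrimrecPred.and
      (Primrec.eq.comp (Primrec.fst.comp Primrec.snd) (Primrec.fst.comp hi'))
      (Primrec.eq.comp (Primrec.snd.comp (Primrec.snd.comp Primrec.snd))
        (Primrec.snd.comp (Primrec.snd.comp hi')))) ?_))
    exact (primrecPred_decodeVec_le (primrec_dim.comp (hx.comp Primrec.fst))
      (Primrec.fst.comp (Primrec.snd.comp Primrec.snd))
      (Primrec.fst.comp (Primrec.snd.comp hi'))).of_eq fun a => decodeVec_le_iff _ _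
  · exact primrecPred_transitions (primrec_dim.comp hx) (primrec_trans.comp hx) hW hM

theorem isSigma1_stackBounded : IsSigma1 fun x : Code => x.toPVAS.StackBounded := by
  refine (IsSigma1.exists_right (p := fun (x : Code)
    (c : List (List ℕ) × List (ℕ × List ℕ × List ℕ)) =>
      x.toPVAS.IsInvariant c.1 (c.2.map (decodeConfig x.1)))
    primrecPred_isInvariant.isSigma1).of_eq fun x => ?_
  rw [stackBounded_iff_exists_isInvariant]
  constructor
  · rintro ⟨c, h⟩
    exact ⟨_, _, h⟩
  · rintro ⟨W, M, h⟩
    -- Decoding of configurations is surjective, so searching over coded lists misses no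
    -- certificate.
    obtain ⟨M, rfl⟩ := List.map_surjective_iff.2 decodeConfig_surjective M
    exact ⟨(W, M), h⟩

end Code

end Primrec

end PVAS

/-! ### Searching for pumping witnesses on codes -/

namespace PVAS

open Relation

namespace Code

/-- Frozen steps between coded configurations; the codes of the frozen counters are listed. -/
def FrozenStep (p : Code × List ℕ) (s t : ℕ × List ℕ × List ℕ) : Prop :=
  p.1.toPVAS.FrozenStep {i | (i : ℕ) ∈ p.2} (decodeConfig p.1.1 s) (decodeConfig p.1.1 t)

/-- A frozen step, or an acceleration that adds a counter to the list of frozen counters. -/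
def AccelStep (x : Code) (p p' : List ℕ × ℕ × List ℕ × List ℕ) : Prop :=
  (p'.1 = p.1 ∧ FrozenStep (x, p.1) p.2 p'.2) ∨
  ∃ e : ℕ × List ℕ, (p' = (e.1 :: p.1, p.2) ∧ e.1 < x.1) ∧
    ReflTransGen (FrozenStep (x, p.1)) (p.2.1, p.2.2.1, []) (p.2.1, e.2, []) ∧
    decodeVec x.1 p.2.2.1 ≤ decodeVec x.1 e.2 ∧ p.2.2.1.getD e.1 0 < e.2.getD e.1 0

theorem frozenReach_of_code {x : Code} {X : List ℕ} {s t : ℕ × List ℕ × List ℕ}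
    (h : ReflTransGen (FrozenStep (x, X)) s t) :
    x.toPVAS.FrozenReach {i | (i : ℕ) ∈ X} (decodeConfig x.1 s) (decodeConfig x.1 t) :=
  ReflTransGen.lift (decodeConfig x.1) (fun _ _ h => h) _ _ h

theorem exists_code_of_frozenReach {x : Code} {X : List ℕ} {s : ℕ × List ℕ × List ℕ}
    {y : Config x.1 ℕ ℕ}
    (h : x.toPVAS.FrozenReach {i | (i : ℕ) ∈ X} (decodeConfig x.1 s) y) :
    ∃ t, decodeConfig x.1 t = y ∧ ReflTransGen (FrozenStep (x, X)) s t := by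
  induction h with
  | refl => exact ⟨s, rfl, .refl⟩
  | @tail y z _ hyz ih =>
    obtain ⟨t, rfl, ht⟩ := ih
    obtain ⟨t', rfl⟩ := decodeConfig_surjective z
    exact ⟨t', rfl, ht.tail hyz⟩

theorem setOf_mem_cons {x : Code} (X : List ℕ) {i : ℕ} (hi : i < x.1) :
    {j : Fin x.1 | (j : ℕ) ∈ i :: X} = insert ⟨i, hi⟩ {j : Fin x.1 | (j : ℕ) ∈ X} := by
  ext j
  change (j : ℕ) ∈ i :: X ↔ j = ⟨i, hi⟩ ∨ (j : ℕ) ∈ X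
  rw [List.mem_cons, Fin.ext_iff]

theorem pumpable_of_code {x : Code} {p : List ℕ × ℕ × List ℕ × List ℕ}
    (h : ReflTransGen (AccelStep x) ([], x.init) p) :
    x.toPVAS.Pumpable {i | (i : ℕ) ∈ p.1} (decodeConfig x.1 p.2) := by
  induction h with
  | refl =>
    have : {i : Fin x.1 | (i : ℕ) ∈ ([] : List ℕ)} = ∅ := by ext; simp
    rw [this]
    exact Pumpable.init
  | @tail p p' _ hpp ih =>
    obtain ⟨Y, t⟩ := p'
    rcases hpp with ⟨h1, h2⟩ | ⟨⟨i, c'⟩, ⟨h1, hi⟩, hr, hle, hlt⟩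
    · obtain rfl : Y = p.1 := h1
      exact ih.step h2
    · obtain ⟨rfl, rfl⟩ := Prod.mk.inj h1
      have := ih.accel (frozenReach_of_code hr) hle (i := ⟨i, hi⟩) hlt
      rwa [← setOf_mem_cons] at this

theorem exists_code_of_pumpable {x : Code} {X : Set (Fin x.1)} {y : Config x.1 ℕ ℕ}
    (h : x.toPVAS.Pumpable X y) : ∃ p : List ℕ × ℕ × List ℕ × List ℕ,
      {i : Fin x.1 | (i : ℕ) ∈ p.1} = X ∧ decodeConfig x.1 p.2 = y ∧
      ReflTransGen (AccelStep x) ([], x.init) p := by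
  induction h with
  | init => exact ⟨([], x.init), by ext; simp, rfl, .refl⟩
  | @step X y z _ hyz ih =>
    obtain ⟨p, rfl, rfl, hp⟩ := ih
    obtain ⟨t, rfl⟩ := decodeConfig_surjective z
    exact ⟨(p.1, t), rfl, rfl, hp.tail (.inl ⟨rfl, hyz⟩)⟩
  | @accel X q c c' w i _ hr hle hlt ih =>
    obtain ⟨⟨Y, q', l, w'⟩, rfl, he, hp⟩ := ih
    simp only [decodeConfig, Prod.mk.injEq] at he
    obtain ⟨rfl, rfl, rfl⟩ := he
    obtain ⟨⟨q'', l', w''⟩, he, ht⟩ := exists_code_of_frozenReach (s := (q', l, [])) hr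
    simp only [decodeConfig, Prod.mk.injEq] at he
    obtain ⟨rfl, rfl, rfl⟩ := he
    exact ⟨((i : ℕ) :: Y, q'', l, w'), setOf_mem_cons Y i.2, rfl,
      hp.tail (.inr ⟨(i, l'), ⟨rfl, i.2⟩, ht, hle, hlt⟩)⟩

/-- This expresses the inductive predicate `Pumpable` through reflexive transitive closures of
relations on codes, to which `IsSigma1.reflTransGen` applies. That closure is used twice, since an
acceleration step itself contains a reachability condition. -/
theorem stackPumpable_toPVAS_iff (x : Code) : x.toPVAS.StackPumpable ↔
    ∃ e : (List ℕ × ℕ × List ℕ × List ℕ) × List ℕ × List ℕ,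
      ReflTransGen (AccelStep x) ([], x.init) e.1 ∧
      ReflTransGen (FrozenStep (x, e.1.1)) (e.1.2.1, e.1.2.2.1, []) (e.1.2.1, e.2) ∧
      decodeVec x.1 e.1.2.2.1 ≤ decodeVec x.1 e.2.1 ∧ e.2.2 ≠ [] := by
  constructor
  · rintro ⟨X, q, c, w, c', u, hp, hr, hle, hu⟩
    obtain ⟨⟨Y, q', l, w'⟩, rfl, he, hpY⟩ := exists_code_of_pumpable hp
    simp only [decodeConfig, Prod.mk.injEq] at he
    obtain ⟨rfl, rfl, rfl⟩ := he
    obtain ⟨⟨q'', l', w''⟩, he, ht⟩ := exists_code_of_frozenReach (s := (q', l, [])) hr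
    simp only [decodeConfig, Prod.mk.injEq] at he
    obtain ⟨rfl, rfl, rfl⟩ := he
    exact ⟨((Y, q'', l, w'), l', w''), hpY, ht, hle, hu⟩
  · rintro ⟨⟨⟨Y, q, l, w⟩, l', u⟩, hp, hr, hle, hu⟩
    exact ⟨_, _, _, _, _, u, pumpable_of_code hp, frozenReach_of_code hr, hle, hu⟩

theorem isSigma1_frozenReach : IsSigma1
    fun z : (Code × List ℕ) × (ℕ × List ℕ × List ℕ) × (ℕ × List ℕ × List ℕ) =>
      ReflTransGen (FrozenStep z.1) z.2.1 z.2.2 :=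
  IsSigma1.reflTransGen (primrecPred_frozenStep (Primrec.fst.comp Primrec.fst)
    (Primrec.snd.comp Primrec.fst) (Primrec.fst.comp Primrec.snd)
    (Primrec.snd.comp Primrec.snd)).isSigma1

theorem isSigma1_accelStep : IsSigma1
    fun z : Code × (List ℕ × ℕ × List ℕ × List ℕ) × (List ℕ × ℕ × List ℕ × List ℕ) =>
      AccelStep z.1 z.2.1 z.2.2 := by
  refine IsSigma1.or ?_ (IsSigma1.exists_right (IsSigma1.and ?_ (IsSigma1.and ?_ ?_)))
  · have hp : Primrec fun z : Code × (List ℕ × ℕ × List ℕ × List ℕ) ×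
        (List ℕ × ℕ × List ℕ × List ℕ) => z.2.1 := Primrec.fst.comp Primrec.snd
    have hp' : Primrec fun z : Code × (List ℕ × ℕ × List ℕ × List ℕ) ×
        (List ℕ × ℕ × List ℕ × List ℕ) => z.2.2 := Primrec.snd.comp Primrec.snd
    exact (PrimrecPred.and (Primrec.eq.comp (Primrec.fst.comp hp') (Primrec.fst.comp hp))
      (primrecPred_frozenStep Primrec.fst (Primrec.fst.comp hp) (Primrec.snd.comp hp)
        (Primrec.snd.comp hp'))).isSigma1
  all_goals
    have hx : Primrec fun z : (Code × (List ℕ × ℕ × List ℕ × List ℕ) ×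
        (List ℕ × ℕ × List ℕ × List ℕ)) × ℕ × List ℕ => z.1.1 := Primrec.fst.comp Primrec.fst
    have hp : Primrec fun z : (Code × (List ℕ × ℕ × List ℕ × List ℕ) ×
        (List ℕ × ℕ × List ℕ × List ℕ)) × ℕ × List ℕ => z.1.2.1 :=
      Primrec.fst.comp (Primrec.snd.comp Primrec.fst)
    have hi : Primrec fun z : (Code × (List ℕ × ℕ × List ℕ × List ℕ) ×
        (List ℕ × ℕ × List ℕ × List ℕ)) × ℕ × List ℕ => z.2.1 := Primrec.fst.comp Primrec.snd
    have hl : Primrec fun z : (Code × (List ℕ × ℕ × List ℕ × List ℕ) ×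
        (List ℕ × ℕ × List ℕ × List ℕ)) × ℕ × List ℕ => z.2.2 := Primrec.snd.comp Primrec.snd
    have hc := Primrec.fst.comp (Primrec.snd.comp (Primrec.snd.comp hp))
    have hq := Primrec.fst.comp (Primrec.snd.comp hp)
  · exact (PrimrecPred.and (Primrec.eq.comp (Primrec.snd.comp (Primrec.snd.comp Primrec.fst))
      (Primrec.pair (Primrec.list_cons.comp hi (Primrec.fst.comp hp)) (Primrec.snd.comp hp)))
      (Primrec.nat_lt.comp hi (primrec_dim.comp hx))).isSigma1
  · exact isSigma1_frozenReach.comp (Primrec.pair (Primrec.pair hx (Primrec.fst.comp hp))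
      (Primrec.pair (Primrec.pair hq (Primrec.pair hc (Primrec.const [])))
        (Primrec.pair hq (Primrec.pair hl (Primrec.const [])))))
  · exact (PrimrecPred.and (primrecPred_decodeVec_le (primrec_dim.comp hx) hc hl)
      (Primrec.nat_lt.comp ((Primrec.list_getD 0).comp hc hi)
        ((Primrec.list_getD 0).comp hl hi))).isSigma1

theorem isSigma1_not_stackBounded : IsSigma1 fun x : Code => ¬ x.toPVAS.StackBounded := by
  refine IsSigma1.of_eq ?_ fun x => (stackPumpable_toPVAS_iff x).symm.trans
    x.toPVAS.stackPumpable_iff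
  have hx : Primrec fun z : Code × (List ℕ × ℕ × List ℕ × List ℕ) × List ℕ × List ℕ => z.1 :=
    Primrec.fst
  have hp : Primrec fun z : Code × (List ℕ × ℕ × List ℕ × List ℕ) × List ℕ × List ℕ => z.2.1 :=
    Primrec.fst.comp Primrec.snd
  have he : Primrec fun z : Code × (List ℕ × ℕ × List ℕ × List ℕ) × List ℕ × List ℕ => z.2.2 :=
    Primrec.snd.comp Primrec.snd
  have hc := Primrec.fst.comp (Primrec.snd.comp (Primrec.snd.comp hp))
  have hq := Primrec.fst.comp (Primrec.snd.comp hp)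
  refine IsSigma1.exists_right (IsSigma1.and ?_ (IsSigma1.and ?_ (PrimrecPred.isSigma1 ?_)))
  · exact (IsSigma1.reflTransGen isSigma1_accelStep).comp (Primrec.pair hx
      (Primrec.pair (Primrec.pair (Primrec.const []) (primrec_init.comp hx)) hp))
  · exact isSigma1_frozenReach.comp (Primrec.pair (Primrec.pair hx (Primrec.fst.comp hp))
      (Primrec.pair (Primrec.pair hq (Primrec.pair hc (Primrec.const []))) (Primrec.pair hq he)))
  · exact (primrecPred_decodeVec_le (primrec_dim.comp hx) hc (Primrec.fst.comp he)).and
      (PrimrecPred.not (Primrec.eq.comp (Primrec.snd.comp he) (Primrec.const [])))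

/-- Post's theorem: the searches for an invariant and for a pumping witness are run in parallel, and
exactly one succeeds. -/
theorem computablePred_stackBounded : ComputablePred fun x : Code => x.toPVAS.StackBounded :=
  ComputablePred.computable_iff_re_compl_re'.2
    ⟨isSigma1_stackBounded.rePred, isSigma1_not_stackBounded.rePred⟩

end Code

end PVAS

theorem mainTheorem4 :
    ∃ D : PVAS.Code → Prop, ComputablePred D ∧
      ∀ (k n m : ℕ) (Q Γ : Type*) (eQ : Q ≃ Fin n) (eΓ : Γ ≃ Fin m) (P : PVAS k Q Γ)
        (ts : List (Q × (Fin k → ℤ) × StackOp Γ × Q)), (∀ t, t ∈ ts ↔ t ∈ P.Δ) →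
        (D (P.code eQ eΓ ts) ↔ P.StackBounded) :=
  ⟨fun x => x.toPVAS.StackBounded, PVAS.Code.computablePred_stackBounded,
    fun _ _ _ _ _ eQ eΓ P ts hts => PVAS.stackBounded_toPVAS_code P eQ eΓ ts hts⟩
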